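/- All graphs are simple and connected, but not necessarily finite, and $d$ denotes the shortest-path distance. A graph is $5$-chordal if it has no induced $n$-cycle with $n>5$. For vertices $x,y,u,v$ of a graph $G$, let $\delta_G(x,y,u,v)$ be the difference between the largest and the second largest (counted with multiplicity) of the three numbers $$\frac{d(u,v)+d(x,y)}{2},\quad \frac{d(u,x)+d(v,y)}{2},\quad \frac{d(u,y)+d(v,x)}{2}.$$ For $\delta\ge 0$, $G$ is $\delta$-hyperbolic if $\delta_G(x,y,u,v)\le\delta$ for all vertices $x,y,u,v$; the hyperbolicity $\delta^*(G)$ is the least $\delta\in\{0,\frac12,1,\frac32,\dots\}$ such that $G$ is $\delta$-hyperbolic, and $\infty$ if there is none. A subgraph $H$ of $G$ is isometric if $d_H(s,t)=d_G(s,t)$ for all vertices $s,t$ of $H$; a graph appears as an isometric subgraph of $G$ if it is isomorphic to an isometric subgraph of $G$. Let $C_4$ be the $4$-cycle. Let $H_1,H_2,H_4,H_5$ be the graphs on the vertices $x,a,u,c,y,d,v,b$ obtained from the $8$-cycle $[x\,a\,u\,c\,y\,d\,v\,b]$ by adding the following edges: $ab,bd,dc,ca,ad$ for $H_1$; $ab,bd,dc,ca,ad,bc$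 for $H_2$; $ad,bc$ for $H_4$; and $ad$ for $H_5$. Let $H_3$ be the graph obtained from the $6$-cycle $[x\,u\,c\,y\,d\,v]$ by adding the edge $cd$. Theorem. Let $G$ be a connected $5$-chordal graph. Then $\delta^*(G)=1$ if and only if at least one of $C_4,H_1,H_2,H_3,H_4,H_5$ appears as an isometric subgraph of $G$. Moreover, $G$ is $\frac12$-hyperbolic if and only if none of these six graphs appears as an isometric subgraph of $G$. -/

import Mathlib

open scoped ENNReal

namespace HypChord

/-- `G` is `k`-chordal: it has no induced `n`-cycle with `n > k`
(an `n`-cycle has `n ≥ 3` distinct vertices). -/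
def IsKChordal {V : Type*} (k : ℕ) (G : SimpleGraph V) : Prop :=
  ∀ n : ℕ, 3 ≤ n → k < n → ¬ (SimpleGraph.cycleGraph n).IsIndContained G

/-- The largest of three reals. -/
noncomputable def largest (p q r : ℝ) : ℝ := max p (max q r)

/-- The second largest of three reals, counted with multiplicity (their median). -/
noncomputable def secondLargest (p q r : ℝ) : ℝ :=
  max (min p q) (max (min p r) (min q r))

/-- `δ_G(x, y, u, v)`: the difference between the largest and the second largest of
`(uv + xy) / 2`, `(ux + vy) / 2` and `(uy + vx) / 2`, where juxtaposition is the graph distance. -/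
noncomputable def quadDefect {V : Type*} (G : SimpleGraph V) (x y u v : V) : ℝ :=
  largest
      (((G.dist u v : ℝ) + G.dist x y) / 2)
      (((G.dist u x : ℝ) + G.dist v y) / 2)
      (((G.dist u y : ℝ) + G.dist v x) / 2)
    - secondLargest
      (((G.dist u v : ℝ) + G.dist x y) / 2)
      (((G.dist u x : ℝ) + G.dist v y) / 2)
      (((G.dist u y : ℝ) + G.dist v x) / 2)

/-- `G` is `δ`-hyperbolic. -/
def IsHyperbolic {V : Type*} (δ : ℝ) (G : SimpleGraph V) : Prop :=
  ∀ x y u v : V, quadDefect G x y u v ≤ δ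

/-- The hyperbolicity `δ*(G)`: the least element `m / 2` of `{0, 1/2, 1, 3/2, …}` such that `G` is
`m / 2`-hyperbolic, and `∞` if there is none. -/
noncomputable def hyperbolicity {V : Type*} (G : SimpleGraph V) : ℝ≥0∞ :=
  ⨅ (m : ℕ) (_ : IsHyperbolic ((m : ℝ) / 2) G), (m : ℝ≥0∞) / 2

/-- A subgraph `S` of `G` is isometric: distances within `S` agree with distances in `G`
(as extended distances, so that a disconnected `S` is not isometric in a connected `G`). -/
def IsIsometricSubgraph {V : Type*} {G : SimpleGraph V} (S : G.Subgraph) : Prop :=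
  ∀ s t : S.verts, S.coe.edist s t = G.edist (s : V) (t : V)

/-- `H` appears as an isometric subgraph of `G`: some isometric subgraph of `G` is
isomorphic to `H`. -/
def AppearsIsometrically {W V : Type*} (H : SimpleGraph W) (G : SimpleGraph V) : Prop :=
  ∃ S : G.Subgraph, IsIsometricSubgraph S ∧ Nonempty (H ≃g S.coe)

/-- The four-cycle. -/
def C4 : SimpleGraph (Fin 4) := SimpleGraph.cycleGraph 4

/-! The graphs on eight vertices below consist of the cycle `[x a u c y d v b]`, whose vertices
are numbered `0, 1, …, 7` in this order
(`x = 0`, `a = 1`, `u = 2`, `c = 3`, `y = 4`, `d = 5`, `v = 6`, `b = 7`), and of chords. -/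

/-- Chords `ab`, `bd`, `dc`, `ca`, `ad`. -/
def H1 : SimpleGraph (Fin 8) :=
  SimpleGraph.cycleGraph 8 ⊔
    SimpleGraph.fromEdgeSet {s(1, 7), s(7, 5), s(5, 3), s(3, 1), s(1, 5)}

/-- Chords `ab`, `bd`, `dc`, `ca`, `ad`, `bc`. -/
def H2 : SimpleGraph (Fin 8) :=
  SimpleGraph.cycleGraph 8 ⊔
    SimpleGraph.fromEdgeSet {s(1, 7), s(7, 5), s(5, 3), s(3, 1), s(1, 5), s(7, 3)}

/-- The cycle `[x u c y d v]`, numbered `0, …, 5` in this order, with the chord `cd`. -/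
def H3 : SimpleGraph (Fin 6) :=
  SimpleGraph.cycleGraph 6 ⊔ SimpleGraph.fromEdgeSet {s(2, 4)}

/-- Chords `ad`, `bc`. -/
def H4 : SimpleGraph (Fin 8) :=
  SimpleGraph.cycleGraph 8 ⊔ SimpleGraph.fromEdgeSet {s(1, 5), s(7, 3)}

/-- Chord `ad`. -/
def H5 : SimpleGraph (Fin 8) :=
  SimpleGraph.cycleGraph 8 ⊔ SimpleGraph.fromEdgeSet {s(1, 5)}

/-- One of the six graphs appears as an isometric subgraph of `G`. -/
def HasObstruction {V : Type*} (G : SimpleGraph V) : Prop :=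
  AppearsIsometrically C4 G ∨ AppearsIsometrically H1 G ∨ AppearsIsometrically H2 G ∨
    AppearsIsometrically H3 G ∨ AppearsIsometrically H4 G ∨ AppearsIsometrically H5 G

end HypChord

/-! By `isHyperbolic_iff`, `k/2`-hyperbolicity means that no quadruple `x u y v` has a diagonal sum
`d(x,y) + d(u,v)` exceeding both side sums by `k + 1`. Each of the six graphs carries a gap of 2,
which an isometric copy preserves. It remains to exclude gaps of 3 in every 5-chordal graph and to
extract an obstruction from a gap of 2.

Take a gap quadruple of least perimeter and join consecutive vertices by geodesics. Minimality
leaves no other vertex between a corner and both of its neighbouring corners (`MinGap.corner`), so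
two sides meeting at a corner are joined only by chords between vertices equidistant from it
(`Corner.eq_of_adj`). If opposite sides have no stray adjacency, that is, none besides edges that
are themselves sides, then cutting each corner at its last chord leaves an induced cycle
(`Frame.cycle`). The two routes along this cycle bound each diagonal; adding these bounds to the gap
inequalities shows that the cycle has length at least `2k`. As its length is at most 5, a gap of 3
is impossible; stray adjacencies force `k = 2` anyway (`MinGap.opposite_adj`).

For a gap of 2, suppose that `C4`, `H3` and `H5` do not appear. Then induced cycles have length 3 or
5, and the neighbours of a vertex that are closer to a given target form a clique
(`intervalNeighborhoodClique`). Without stray adjacencies the cut cycle has length 5, and some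
diagonal is realised along both routes and has an uncut end (`cut_arith`); the two neighbours of
that end on the sides must then be adjacent, a contradiction. So some opposite sides are adjacent.
Minimality and a pentagon argument force all sides to have length 2 (`MinGap.eq_one_of_adj`), and
the resulting square yields `H1` or `H2`, possibly after replacing midpoints of sides
(`IsSquare.appears`). The graph `H4` contains the induced six-cycle `u a d v b c`, so the extraction
never needs it. -/

namespace HypChord

open SimpleGraph

variable {V : Type*} {G : SimpleGraph V}

/-! ### Geodesics, induced paths and the induced cycles they bound -/

/-- `f 0, …, f n` is an isometrically embedded path. -/
def IsGeo (G : SimpleGraph V) (f : ℕ → V) (n : ℕ) : Prop :=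
  ∀ i j, i ≤ j → j ≤ n → G.dist (f i) (f j) = j - i

/-- `f 0, …, f n` is an induced path. -/
def IsIndPath (G : SimpleGraph V) (f : ℕ → V) (n : ℕ) : Prop :=
  ∀ i j, i < j → j ≤ n → f i ≠ f j ∧ (G.Adj (f i) (f j) ↔ j = i + 1)

lemma exists_isGeo (hc : G.Connected) (x y : V) :
    ∃ f : ℕ → V, f 0 = x ∧ f (G.dist x y) = y ∧ IsGeo G f (G.dist x y) := by
  obtain ⟨p, hp⟩ := hc.exists_walk_length_eq_dist x y
  refine ⟨p.getVert, p.getVert_zero, by rw [← hp]; exact p.getVert_length, ?_⟩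
  have key : ∀ i j, i ≤ j → j ≤ p.length → G.dist (p.getVert i) (p.getVert j) ≤ j - i := by
    intro i j hij hj
    have h := dist_le ((p.drop i).take (j - i))
    rw [Walk.take_length, Walk.drop_getVert, Nat.add_sub_cancel' hij] at h
    exact h.trans (min_le_left _ _)
  intro i j hij hj
  rw [← hp] at hj
  have h1 := key i j hij hj
  have h2 := key 0 i (by omega) (by omega)
  have h3 := key j p.length hj le_rfl
  rw [p.getVert_zero] at h2
  rw [p.getVert_length] at h3
  have t1 := hc.dist_triangle (u := x) (v := p.getVert i) (w := y)
  have t2 := hc.dist_triangle (u := p.getVert i) (v := p.getVert j) (w := y)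
  omega

lemma IsGeo.dist_zero {f : ℕ → V} {n : ℕ} (h : IsGeo G f n) {i : ℕ} (hi : i ≤ n) :
    G.dist (f 0) (f i) = i := by
  simpa using h 0 i (by omega) hi

lemma IsGeo.dist_last {f : ℕ → V} {n : ℕ} (h : IsGeo G f n) {i : ℕ} (hi : i ≤ n) :
    G.dist (f i) (f n) = n - i := h i n hi le_rfl

lemma IsGeo.adj {f : ℕ → V} {n : ℕ} (h : IsGeo G f n) {i : ℕ} (hi : i + 1 ≤ n) :
    G.Adj (f i) (f (i + 1)) := by
  rw [← dist_eq_one_iff_adj, h i (i + 1) (by omega) hi]; omega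

lemma IsGeo.reverse {f : ℕ → V} {n : ℕ} (h : IsGeo G f n) : IsGeo G (fun i => f (n - i)) n := by
  intro i j hij hj
  rw [dist_comm, h (n - j) (n - i) (by omega) (by omega)]
  omega

lemma IsGeo.shift {f : ℕ → V} {n : ℕ} (h : IsGeo G f n) (s : ℕ) {m : ℕ} (hm : s + m ≤ n) :
    IsGeo G (fun i => f (s + i)) m := by
  intro i j hij hj
  rw [h (s + i) (s + j) (by omega) (by omega)]
  omega

lemma IsGeo.mono {f : ℕ → V} {n : ℕ} (h : IsGeo G f n) {m : ℕ} (hm : m ≤ n) : IsGeo G f m :=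
  fun i j hij hj => h i j hij (by omega)

lemma IsGeo.isIndPath {f : ℕ → V} {n : ℕ} (h : IsGeo G f n) : IsIndPath G f n := by
  intro i j hij hj
  have := h i j hij.le hj
  refine ⟨fun he => ?_, ?_⟩
  · rw [he, dist_self] at this; omega
  · rw [← dist_eq_one_iff_adj, this]; omega

/-- The sequence `f 0, …, f m, g 0, g 1, …`. -/
def glue (f : ℕ → V) (m : ℕ) (g : ℕ → V) (i : ℕ) : V := if i ≤ m then f i else g (i - (m + 1))

lemma glue_left {f g : ℕ → V} {m i : ℕ} (h : i ≤ m) : glue f m g i = f i := if_pos h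

lemma glue_right {f g : ℕ → V} {m i : ℕ} (h : ¬ i ≤ m) : glue f m g i = g (i - (m + 1)) := if_neg h

lemma IsIndPath.glue {f g : ℕ → V} {m n : ℕ} (hf : IsIndPath G f m) (hg : IsIndPath G g n)
    (h : ∀ i j, i ≤ m → j ≤ n → f i ≠ g j ∧ (G.Adj (f i) (g j) ↔ i = m ∧ j = 0)) :
    IsIndPath G (glue f m g) (m + n + 1) := by
  intro i j hij hj
  by_cases hi : i ≤ m
  · by_cases hj' : j ≤ m
    · rw [glue_left hi, glue_left hj']; exact hf i j hij hj'
    · rw [glue_left hi, glue_right hj']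
      obtain ⟨h1, h2⟩ := h i (j - (m + 1)) hi (by omega)
      exact ⟨h1, h2.trans (by omega)⟩
  · rw [glue_right hi, glue_right (by omega)]
    obtain ⟨h1, h2⟩ := hg (i - (m + 1)) (j - (m + 1)) (by omega) (by omega)
    exact ⟨h1, h2.trans (by omega)⟩

lemma cycleGraph_isIndContained {f : ℕ → V} {N : ℕ}
    (h : ∀ i j, i < j → j < N → f i ≠ f j ∧
      (G.Adj (f i) (f j) ↔ j = i + 1 ∨ (i = 0 ∧ j + 1 = N))) :
    (cycleGraph N).IsIndContained G := by
  have hinj : ∀ i j : Fin N, f i = f j → i = j := by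
    intro i j he
    rcases lt_trichotomy i.1 j.1 with hl | hl | hl
    · exact absurd he (h i j hl j.2).1
    · exact Fin.ext hl
    · exact absurd he.symm (h j i hl i.2).1
  have hlt : ∀ i j : Fin N, i.1 < j.1 → (G.Adj (f i) (f j) ↔ (cycleGraph N).Adj i j) := by
    intro i j hl
    rw [(h i j hl j.2).2, cycleGraph_adj', Fin.sub_def, Fin.sub_def]
    have hj := j.2
    simp only
    -- Subtraction in `Fin N` is modulo `N`: the difference `i - j` is `N - (j - i)`, which is 1
    -- exactly for the pair closing the cycle.
    rw [show N - j.1 + i.1 = N - (j.1 - i.1) by omega, Nat.mod_eq_of_lt (by omega),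
      show N - i.1 + j.1 = (j.1 - i.1) + N by omega, Nat.add_mod_right,
      Nat.mod_eq_of_lt (by omega)]
    omega
  refine ⟨⟨⟨fun i : Fin N => f i.1, fun i j he => hinj i j he⟩, ?_⟩⟩
  intro i j
  change G.Adj (f i) (f j) ↔ _
  rcases lt_trichotomy i.1 j.1 with hl | hl | hl
  · exact hlt i j hl
  · have : i = j := Fin.ext hl
    subst this
    simp
  · rw [G.adj_comm, (cycleGraph N).adj_comm]; exact hlt j i hl

/-- Two induced paths joined at both ends form an induced cycle. -/
lemma IsIndPath.cycle {f g : ℕ → V} {m n : ℕ} (hf : IsIndPath G f m) (hg : IsIndPath G g n)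
    (h : ∀ i j, i ≤ m → j ≤ n → f i ≠ g j ∧
      (G.Adj (f i) (g j) ↔ (i = m ∧ j = 0) ∨ (i = 0 ∧ j = n))) :
    (cycleGraph (m + n + 2)).IsIndContained G := by
  refine cycleGraph_isIndContained (f := HypChord.glue f m g) ?_
  intro i j hij hj
  by_cases hi : i ≤ m
  · by_cases hj' : j ≤ m
    · rw [glue_left hi, glue_left hj']
      obtain ⟨h1, h2⟩ := hf i j hij hj'
      exact ⟨h1, h2.trans (by omega)⟩
    · rw [glue_left hi, glue_right hj']
      obtain ⟨h1, h2⟩ := h i (j - (m + 1)) hi (by omega)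
      exact ⟨h1, h2.trans (by omega)⟩
  · rw [glue_right hi, glue_right (by omega)]
    obtain ⟨h1, h2⟩ := hg (i - (m + 1)) (j - (m + 1)) (by omega) (by omega)
    exact ⟨h1, h2.trans (by omega)⟩

/-! ### Isometric copies and distance tables -/

lemma edist_hom_le {W₁ W₂ : Type*} {H₁ : SimpleGraph W₁} {H₂ : SimpleGraph W₂} (g : H₁ →g H₂)
    (a b : W₁) : H₂.edist (g a) (g b) ≤ H₁.edist a b := by
  by_cases hr : H₁.Reachable a b
  · obtain ⟨p, hp⟩ := hr.exists_walk_length_eq_edist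
    rw [← hp]
    calc H₂.edist (g a) (g b) ≤ ((p.map g).length : ℕ∞) := edist_le _
      _ = _ := by rw [Walk.length_map]
  · have : H₁.edist a b = ⊤ := by
      by_contra h
      exact hr (edist_ne_top_iff_reachable.1 h)
    rw [this]; exact le_top

/-- A copy of `H` in `G` that does not shorten distances is an isometric subgraph. -/
lemma appearsIsometrically_of_embedding {W : Type*} {H : SimpleGraph W} (f : H ↪g G)
    (hd : ∀ i j, H.edist i j ≤ G.edist (f i) (f j)) : AppearsIsometrically H G := by
  let S : G.Subgraph := (⊤ : H.Subgraph).map f.toHom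
  have hv : ∀ i, f i ∈ S.verts := fun i => ⟨i, trivial, rfl⟩
  let φ : W → S.verts := fun i => ⟨f i, hv i⟩
  have hφ : Function.Bijective φ := by
    refine ⟨fun i j h => f.injective (congrArg Subtype.val h), ?_⟩
    rintro ⟨_, i, -, rfl⟩
    exact ⟨i, rfl⟩
  have hadj : ∀ i j, S.coe.Adj (φ i) (φ j) ↔ H.Adj i j := by
    intro i j
    rw [Subgraph.coe_adj]
    constructor
    · intro h
      exact f.map_adj_iff.1 h.adj_sub
    · intro h
      exact ⟨i, j, h, rfl, rfl⟩
  let e : H ≃g S.coe := ⟨Equiv.ofBijective φ hφ, fun {i j} => hadj i j⟩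
  refine ⟨S, ?_, ⟨e⟩⟩
  intro s t
  obtain ⟨i, rfl⟩ := hφ.2 s
  obtain ⟨j, rfl⟩ := hφ.2 t
  apply le_antisymm
  · exact (edist_hom_le e.toHom i j).trans (hd i j)
  · exact edist_hom_le S.hom (φ i) (φ j)

/-- `D` is the distance function of `H`. -/
structure IsDistTable {n : ℕ} (H : SimpleGraph (Fin n)) (D : Fin n → Fin n → ℕ) : Prop where
  self : ∀ i, D i i = 0
  step : ∀ i j, i ≠ j → ∃ m, H.Adj i m ∧ D m j + 1 = D i j
  lip : ∀ i m, H.Adj i m → ∀ j, D i j ≤ D m j + 1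

namespace IsDistTable

variable {n : ℕ} {H : SimpleGraph (Fin n)} {D : Fin n → Fin n → ℕ}

lemma exists_walk (h : IsDistTable H D) (j : Fin n) :
    ∀ (k : ℕ) (i : Fin n), D i j = k → ∃ p : H.Walk i j, p.length = k := by
  intro k
  induction k with
  | zero =>
    intro i hi
    by_cases hij : i = j
    · subst hij; exact ⟨Walk.nil, rfl⟩
    · obtain ⟨m, -, hm⟩ := h.step i j hij; omega
  | succ k ih =>
    intro i hi
    have hij : i ≠ j := by rintro rfl; have := h.self i; omega
    obtain ⟨m, hm, hD⟩ := h.step i j hij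
    obtain ⟨p, hp⟩ := ih m (by omega)
    exact ⟨Walk.cons hm p, by simp [hp]⟩

lemma le_length (h : IsDistTable H D) {i j : Fin n} (p : H.Walk i j) : D i j ≤ p.length := by
  induction p with
  | nil => simp [h.self]
  | cons ha p ih => rw [Walk.length_cons]; exact (h.lip _ _ ha _).trans (by omega)

lemma reachable (h : IsDistTable H D) (i j : Fin n) : H.Reachable i j :=
  (h.exists_walk j _ i rfl).elim fun p _ => ⟨p⟩

/-- Descending along `step` produces a walk of length `D i j`, and `lip` forbids a shorter one. Both
conditions are local, hence decidable for a concrete graph. -/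
lemma dist_eq (h : IsDistTable H D) (i j : Fin n) : H.dist i j = D i j := by
  obtain ⟨p, hp⟩ := h.exists_walk j _ i rfl
  obtain ⟨q, hq⟩ := (h.reachable i j).exists_walk_length_eq_dist
  have h1 := dist_le p
  have h2 := h.le_length q
  omega

lemma appearsIsometrically_iff (h : IsDistTable H D) (hc : G.Connected) :
    AppearsIsometrically H G ↔ ∃ f : Fin n → V, ∀ i j, G.dist (f i) (f j) = D i j := by
  constructor
  · rintro ⟨S, hS, ⟨e⟩⟩
    refine ⟨fun i => (e i : V), fun i j => ?_⟩
    have h1 : S.coe.edist (e i) (e j) = H.edist i j := by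
      apply le_antisymm
      · exact edist_hom_le e.toHom i j
      · simpa using edist_hom_le e.symm.toHom (e i) (e j)
    rw [← h.dist_eq, SimpleGraph.dist, SimpleGraph.dist, ← hS, h1]
  · rintro ⟨f, hf⟩
    have hinj : Function.Injective f := by
      intro i j he
      by_contra hij
      obtain ⟨m, -, hm⟩ := h.step i j hij
      have := hf i j
      rw [he, dist_self] at this
      omega
    refine appearsIsometrically_of_embedding ⟨⟨f, hinj⟩, ?_⟩ ?_
    · intro i j
      change G.Adj (f i) (f j) ↔ _
      rw [← dist_eq_one_iff_adj, ← dist_eq_one_iff_adj, hf, h.dist_eq]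
    · intro i j
      change _ ≤ G.edist (f i) (f j)
      rw [← (h.reachable i j).coe_dist_eq_edist, ← (hc (f i) (f j)).coe_dist_eq_edist, hf,
        h.dist_eq]

/-- To find an isometric copy, only adjacencies and lower bounds for distances are needed. -/
lemma appearsIsometrically (h : IsDistTable H D) (hc : G.Connected) (f : Fin n → V)
    (hadj : ∀ i j, i < j → H.Adj i j → G.Adj (f i) (f j))
    (hd : ∀ i j, i < j → ¬ H.Adj i j → D i j ≤ G.dist (f i) (f j)) :
    AppearsIsometrically H G := by
  have hadj' : ∀ i j, H.Adj i j → G.Adj (f i) (f j) := by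
    intro i j hij
    rcases lt_or_gt_of_ne hij.ne with hl | hl
    · exact hadj i j hl hij
    · exact (hadj j i hl hij.symm).symm
  have hlt : ∀ i j, i < j → G.dist (f i) (f j) = D i j := by
    intro i j hl
    apply le_antisymm
    · obtain ⟨p, hp⟩ := h.exists_walk j _ i rfl
      have := dist_le (p.map (⟨f, fun {a b} hab => hadj' a b hab⟩ : H →g G))
      rw [Walk.length_map, hp] at this
      exact this
    · by_cases ha : H.Adj i j
      · rw [← h.dist_eq, dist_eq_one_iff_adj.2 ha, dist_eq_one_iff_adj.2 (hadj i j hl ha)]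
      · exact hd i j hl ha
  refine (h.appearsIsometrically_iff hc).2 ⟨f, fun i j => ?_⟩
  rcases lt_trichotomy i j with hl | rfl | hl
  · exact hlt i j hl
  · rw [dist_self, h.self]
  · rw [dist_comm, hlt j i hl, ← h.dist_eq, ← h.dist_eq, dist_comm]

lemma appearsIsometrically_of_list (h : IsDistTable H D) (hc : G.Connected) (f : Fin n → V)
    (L : List (Fin n × Fin n)) (hL : ∀ i j, i < j → (i, j) ∈ L ∨ H.Adj i j)
    (L' : List (Fin n × Fin n)) (hL' : ∀ i j, i < j → (i, j) ∈ L' ∨ ¬ H.Adj i j)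
    (hadj : L'.Forall fun p => G.Adj (f p.1) (f p.2))
    (hd : L.Forall fun p => D p.1 p.2 ≤ G.dist (f p.1) (f p.2)) :
    AppearsIsometrically H G := by
  rw [List.forall_iff_forall_mem] at hadj hd
  exact h.appearsIsometrically hc f
    (fun i j hij ha => hadj (i, j) ((hL' i j hij).resolve_right (not_not.2 ha)))
    (fun i j hij ha => hd (i, j) ((hL i j hij).resolve_right ha))

end IsDistTable

/-! ### Distance tables of the six graphs -/

instance : DecidableRel C4.Adj := inferInstanceAs (DecidableRel (cycleGraph 4).Adj)

instance : DecidableRel H1.Adj :=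
  inferInstanceAs (DecidableRel (cycleGraph 8 ⊔ fromEdgeSet
    {s(1, 7), s(7, 5), s(5, 3), s(3, 1), s(1, 5)}).Adj)

instance : DecidableRel H2.Adj :=
  inferInstanceAs (DecidableRel (cycleGraph 8 ⊔ fromEdgeSet
    {s(1, 7), s(7, 5), s(5, 3), s(3, 1), s(1, 5), s(7, 3)}).Adj)

instance : DecidableRel H3.Adj :=
  inferInstanceAs (DecidableRel (cycleGraph 6 ⊔ fromEdgeSet
    {s(2, 4)}).Adj)

instance : DecidableRel H4.Adj :=
  inferInstanceAs (DecidableRel (cycleGraph 8 ⊔ fromEdgeSet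
    {s(1, 5), s(7, 3)}).Adj)

instance : DecidableRel H5.Adj :=
  inferInstanceAs (DecidableRel (cycleGraph 8 ⊔ fromEdgeSet
    {s(1, 5)}).Adj)

/-- The distances in `C4`. -/
def distC4 : Fin 4 → Fin 4 → ℕ :=
  ![![0, 1, 2, 1], ![1, 0, 1, 2], ![2, 1, 0, 1],
    ![1, 2, 1, 0]]

lemma isDistTable_C4 : IsDistTable C4 distC4 :=
  ⟨by decide, by decide, by decide⟩

/-- The distances in `H1`. -/
def distH1 : Fin 8 → Fin 8 → ℕ :=
  ![![0, 1, 2, 2, 3, 2, 2, 1], ![1, 0, 1, 1, 2, 1, 2, 1], ![2, 1, 0, 1, 2, 2, 3, 2],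
    ![2, 1, 1, 0, 1, 1, 2, 2], ![3, 2, 2, 1, 0, 1, 2, 2], ![2, 1, 2, 1, 1, 0, 1, 1],
    ![2, 2, 3, 2, 2, 1, 0, 1], ![1, 1, 2, 2, 2, 1, 1, 0]]

lemma isDistTable_H1 : IsDistTable H1 distH1 :=
  ⟨by decide, by decide, by decide⟩

/-- The distances in `H2`. -/
def distH2 : Fin 8 → Fin 8 → ℕ :=
  ![![0, 1, 2, 2, 3, 2, 2, 1], ![1, 0, 1, 1, 2, 1, 2, 1], ![2, 1, 0, 1, 2, 2, 3, 2],
    ![2, 1, 1, 0, 1, 1, 2, 1], ![3, 2, 2, 1, 0, 1, 2, 2], ![2, 1, 2, 1, 1, 0, 1, 1],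
    ![2, 2, 3, 2, 2, 1, 0, 1], ![1, 1, 2, 1, 2, 1, 1, 0]]

lemma isDistTable_H2 : IsDistTable H2 distH2 :=
  ⟨by decide, by decide, by decide⟩

/-- The distances in `H3`. -/
def distH3 : Fin 6 → Fin 6 → ℕ :=
  ![![0, 1, 2, 3, 2, 1], ![1, 0, 1, 2, 2, 2], ![2, 1, 0, 1, 1, 2],
    ![3, 2, 1, 0, 1, 2], ![2, 2, 1, 1, 0, 1], ![1, 2, 2, 2, 1, 0]]

lemma isDistTable_H3 : IsDistTable H3 distH3 :=
  ⟨by decide, by decide, by decide⟩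

/-- The distances in `H4`. -/
def distH4 : Fin 8 → Fin 8 → ℕ :=
  ![![0, 1, 2, 2, 3, 2, 2, 1], ![1, 0, 1, 2, 2, 1, 2, 2], ![2, 1, 0, 1, 2, 2, 3, 2],
    ![2, 2, 1, 0, 1, 2, 2, 1], ![3, 2, 2, 1, 0, 1, 2, 2], ![2, 1, 2, 2, 1, 0, 1, 2],
    ![2, 2, 3, 2, 2, 1, 0, 1], ![1, 2, 2, 1, 2, 2, 1, 0]]

lemma isDistTable_H4 : IsDistTable H4 distH4 :=
  ⟨by decide, by decide, by decide⟩

/-- The distances in `H5`. -/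
def distH5 : Fin 8 → Fin 8 → ℕ :=
  ![![0, 1, 2, 3, 3, 2, 2, 1], ![1, 0, 1, 2, 2, 1, 2, 2], ![2, 1, 0, 1, 2, 2, 3, 3],
    ![3, 2, 1, 0, 1, 2, 3, 4], ![3, 2, 2, 1, 0, 1, 2, 3], ![2, 1, 2, 2, 1, 0, 1, 2],
    ![2, 2, 3, 3, 2, 1, 0, 1], ![1, 2, 3, 4, 3, 2, 1, 0]]

lemma isDistTable_H5 : IsDistTable H5 distH5 :=
  ⟨by decide, by decide, by decide⟩

/-! ### Hyperbolicity as absence of gaps -/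

/-- The sum `d(x, y) + d(u, v)` exceeds the other two sums by at least `k`. -/
def Gap (G : SimpleGraph V) (k : ℕ) (x u y v : V) : Prop :=
  G.dist x u + G.dist y v + k ≤ G.dist x y + G.dist u v ∧
    G.dist x v + G.dist u y + k ≤ G.dist x y + G.dist u v

lemma largest_sub_secondLargest_le_iff (p q r k : ℕ) :
    largest ((p : ℝ) / 2) ((q : ℝ) / 2) ((r : ℝ) / 2)
        - secondLargest ((p : ℝ) / 2) ((q : ℝ) / 2) ((r : ℝ) / 2) ≤ (k : ℝ) / 2 ↔
      (p ≤ q + k ∨ p ≤ r + k) ∧ (q ≤ p + k ∨ q ≤ r + k) ∧ (r ≤ p + k ∨ r ≤ q + k) := by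
  have key : ∀ a b c : ℕ, c ≤ b → b ≤ a →
      (((a : ℝ) / 2 - (b : ℝ) / 2 ≤ (k : ℝ) / 2 ↔ a ≤ b + k)) := by
    intro a b c _ _
    rw [← Nat.cast_le (α := ℝ)]
    push_cast
    constructor <;> intro h <;> linarith
  have hm : ∀ a b : ℕ, a ≤ b → max ((a : ℝ) / 2) ((b : ℝ) / 2) = (b : ℝ) / 2 ∧
      max ((b : ℝ) / 2) ((a : ℝ) / 2) = (b : ℝ) / 2 ∧
      min ((a : ℝ) / 2) ((b : ℝ) / 2) = (a : ℝ) / 2 ∧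
      min ((b : ℝ) / 2) ((a : ℝ) / 2) = (a : ℝ) / 2 := by
    intro a b h
    have h' : (a : ℝ) / 2 ≤ (b : ℝ) / 2 := by
      have : (a : ℝ) ≤ b := by exact_mod_cast h
      linarith
    exact ⟨max_eq_right h', max_eq_left h', min_eq_left h', min_eq_right h'⟩
  unfold largest secondLargest
  rcases le_total p q with h1 | h1 <;> rcases le_total q r with h2 | h2 <;>
    rcases le_total p r with h3 | h3 <;>
    simp only [hm _ _ h1, hm _ _ h2, hm _ _ h3, max_self]
  · rw [key r q p h1 h2]; omega
  · obtain rfl : p = q := by omega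
    obtain rfl : p = r := by omega
    rw [key p p p le_rfl le_rfl]; omega
  · rw [key q r p h3 h2]; omega
  · rw [key q p r h3 h1]; omega
  · rw [key r p q h1 h3]; omega
  · rw [key p r q h2 h3]; omega
  · obtain rfl : p = q := by omega
    obtain rfl : p = r := by omega
    rw [key p p p le_rfl le_rfl]; omega
  · rw [key p q r h2 h1]; omega

/-- Any of the three sums may be the largest, but permuting the four vertices turns it into the
diagonal sum. Distances are integers, so exceeding by more than `k` means by at least `k + 1`. -/
lemma isHyperbolic_iff (k : ℕ) :
    IsHyperbolic ((k : ℝ) / 2) G ↔ ∀ x u y v, ¬ Gap G (k + 1) x u y v := by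
  have hq : ∀ x y u v : V, quadDefect G x y u v ≤ (k : ℝ) / 2 ↔
      _ := fun x y u v => by
    have := largest_sub_secondLargest_le_iff (G.dist u v + G.dist x y)
      (G.dist u x + G.dist v y) (G.dist u y + G.dist v x) k
    push_cast at this
    exact this
  unfold IsHyperbolic
  simp only [hq]
  constructor
  · intro h x u y v hg
    obtain ⟨h1, -, -⟩ := h x y u v
    obtain ⟨g1, g2⟩ := hg
    rw [G.dist_comm (u := u) (v := x), G.dist_comm (u := v) (v := y),
      G.dist_comm (u := v) (v := x)] at h1
    omega
  · intro h x y u v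
    have g1 := h x u y v
    have g2 := h x y u v
    have g3 := h x u v y
    unfold Gap at g1 g2 g3
    rw [G.dist_comm (u := u) (v := x), G.dist_comm (u := v) (v := y),
      G.dist_comm (u := v) (v := x)]
    rw [G.dist_comm (u := y) (v := u)] at g2
    rw [G.dist_comm (u := v) (v := y)] at g3
    omega

lemma IsHyperbolic.mono {δ ε : ℝ} (h : IsHyperbolic δ G) (hle : δ ≤ ε) : IsHyperbolic ε G :=
  fun x y u v => (h x y u v).trans hle

lemma hyperbolicity_eq_one_iff :
    hyperbolicity G = 1 ↔ IsHyperbolic 1 G ∧ ¬ IsHyperbolic (1 / 2) G := by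
  have hle : ∀ m : ℕ, IsHyperbolic ((m : ℝ) / 2) G → hyperbolicity G ≤ (m : ℝ≥0∞) / 2 :=
    fun m hm => iInf₂_le m hm
  constructor
  · intro h
    constructor
    · by_contra hn
      have : (3 : ℝ≥0∞) / 2 ≤ hyperbolicity G := by
        refine le_iInf₂ fun m hm => ?_
        have h3 : 3 ≤ m := by
          by_contra hlt
          refine hn (hm.mono ?_)
          have : (m : ℝ) ≤ 2 := by exact_mod_cast (by omega : m ≤ 2)
          linarith
        exact ENNReal.div_le_div_right (by exact_mod_cast h3) _
      rw [h, ENNReal.div_le_iff_le_mul (by simp) (by simp)] at this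
      norm_num at this
    · intro hh
      have := hle 1 (by simpa using hh)
      rw [h, ENNReal.le_div_iff_mul_le (by simp) (by simp)] at this
      norm_num at this
  · rintro ⟨h1, h2⟩
    apply le_antisymm
    · have := hle 2 (by simpa using h1)
      rwa [Nat.cast_ofNat, ENNReal.div_self (by simp) (by simp)] at this
    · refine le_iInf₂ fun m hm => ?_
      have h3 : 2 ≤ m := by
        by_contra hlt
        refine h2 (hm.mono ?_)
        have : (m : ℝ) ≤ 1 := by exact_mod_cast (by omega : m ≤ 1)
        linarith
      rw [ENNReal.le_div_iff_mul_le (by simp) (by simp), one_mul]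
      exact_mod_cast h3

lemma HasObstruction.exists_gap (hc : G.Connected) (h : HasObstruction G) :
    ∃ x u y v, Gap G 2 x u y v := by
  have key : ∀ {n : ℕ} {H : SimpleGraph (Fin n)} {D : Fin n → Fin n → ℕ}, IsDistTable H D →
      AppearsIsometrically H G → ∀ x u y v : Fin n,
      (D x u + D y v + 2 ≤ D x y + D u v ∧ D x v + D u y + 2 ≤ D x y + D u v) →
      ∃ x u y v, Gap G 2 x u y v := by
    intro n H D hT hA x u y v hD
    obtain ⟨f, hf⟩ := (hT.appearsIsometrically_iff hc).1 hA
    refine ⟨f x, f u, f y, f v, ?_⟩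
    simpa only [Gap, hf] using hD
  rcases h with h | h | h | h | h | h
  -- Outside `C4`, the indices are those of `x, u, y, v` along the defining cycle.
  · exact key isDistTable_C4 h 0 1 2 3 (by decide)
  · exact key isDistTable_H1 h 0 2 4 6 (by decide)
  · exact key isDistTable_H2 h 0 2 4 6 (by decide)
  · exact key isDistTable_H3 h 0 1 3 5 (by decide)
  · exact key isDistTable_H4 h 0 2 4 6 (by decide)
  · exact key isDistTable_H5 h 0 2 4 6 (by decide)

/-! ### Neighbours closer to a target -/

/-- `G` has no induced cycles of length other than `3` and `5`. -/
def OnlyShortOddCycles (G : SimpleGraph V) : Prop :=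
  ∀ N, (N = 4 ∨ 6 ≤ N) → ¬ (cycleGraph N).IsIndContained G

/-- The neighbours of `x` that are closer to `y` than `x` form a clique. -/
def IntervalNeighborhoodClique (G : SimpleGraph V) : Prop :=
  ∀ x y p q, G.Adj x p → G.Adj x q → p ≠ q → G.dist p y + 1 ≤ G.dist x y →
    G.dist q y + 1 ≤ G.dist x y → G.Adj p q

lemma isGeo_of_adj (hc : G.Connected) {f : ℕ → V} {n : ℕ} (h : ∀ i, i < n → G.Adj (f i) (f (i + 1)))
    (hd : n ≤ G.dist (f 0) (f n)) : IsGeo G f n := by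
  have key : ∀ m i, i + m ≤ n → G.dist (f i) (f (i + m)) ≤ m := by
    intro m
    induction m with
    | zero => intro i _; simp
    | succ m ih =>
      intro i hi
      have h1 := ih i (by omega)
      have h2 := dist_eq_one_iff_adj.2 (h (i + m) (by omega))
      have h3 := hc.dist_triangle (u := f i) (v := f (i + m)) (w := f (i + m + 1))
      rw [← add_assoc]
      omega
  intro i j hij hj
  have h1 := key (j - i) i (by omega)
  have h2 := key i 0 (by omega)
  have h3 := key (n - j) j (by omega)
  rw [Nat.add_sub_cancel' hij] at h1
  rw [zero_add] at h2
  rw [Nat.add_sub_cancel' hj] at h3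
  have t1 := hc.dist_triangle (u := f 0) (v := f i) (w := f n)
  have t2 := hc.dist_triangle (u := f i) (v := f j) (w := f n)
  omega

lemma exists_isGeo_through (hc : G.Connected) {x y p : V} (hp : G.Adj x p)
    (hd : G.dist p y + 1 ≤ G.dist x y) :
    ∃ f : ℕ → V, f 0 = x ∧ f 1 = p ∧ f (G.dist x y) = y ∧ IsGeo G f (G.dist x y) := by
  obtain ⟨g, g0, gn, hg⟩ := exists_isGeo hc p y
  have h1 := dist_eq_one_iff_adj.2 hp
  have t1 := hc.dist_triangle (u := x) (v := p) (w := y)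
  have hk : G.dist x y = G.dist p y + 1 := by omega
  refine ⟨fun i => if i = 0 then x else g (i - 1), by simp, by simpa using g0, ?_, ?_⟩
  · rw [hk]; simpa using gn
  · apply isGeo_of_adj hc
    · intro i hi
      rcases Nat.eq_zero_or_pos i with rfl | hpos
      · simpa [g0] using hp
      · have := hg.adj (i := i - 1) (by omega)
        rw [Nat.sub_add_cancel hpos] at this
        simpa [hpos.ne'] using this
    · rw [hk]; simp [gn, hk]

lemma Adj.le_succ_dist (hc : G.Connected) {p q : V} (h : G.Adj p q) (y : V) :
    G.dist p y ≤ G.dist q y + 1 := by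
  have h1 := dist_eq_one_iff_adj.2 h
  have t1 := hc.dist_triangle (u := p) (v := q) (w := y)
  omega

/-- Two geodesics whose only adjacencies are at their ends bound an induced cycle. -/
lemma IsGeo.cycle {P Q : ℕ → V} {k l s t s' t' : ℕ} (hP : IsGeo G P k) (hQ : IsGeo G Q l)
    (hst : s ≤ t) (ht : t ≤ k) (hst' : s' ≤ t') (ht' : t' ≤ l)
    (h : ∀ i j, s ≤ i → i ≤ t → s' ≤ j → j ≤ t' → P i ≠ Q j ∧
      (G.Adj (P i) (Q j) ↔ (i = t ∧ j = t') ∨ (i = s ∧ j = s'))) :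
    (cycleGraph ((t - s) + (t' - s') + 2)).IsIndContained G := by
  have hQ' := (((hQ.shift s' (m := t' - s') (by omega))).reverse).isIndPath
  refine IsIndPath.cycle ((hP.shift s (m := t - s) (by omega)).isIndPath) hQ' ?_
  intro i j hi hj
  obtain ⟨h1, h2⟩ := h (s + i) (s' + (t' - s' - j)) (by omega) (by omega) (by omega) (by omega)
  exact ⟨h1, h2.trans (by omega)⟩

lemma appears_C4 (hc : G.Connected) (h : (cycleGraph 4).IsIndContained G) :
    AppearsIsometrically C4 G := by
  obtain ⟨f⟩ := h
  refine isDistTable_C4.appearsIsometrically hc f ?_ ?_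
  · intro i j _ ha
    exact f.map_adj_iff.2 ha
  · intro i j hij ha
    have h1 : ¬ G.Adj (f i) (f j) := fun h => ha (f.map_adj_iff.1 h)
    have h2 : f i ≠ f j := fun h => hij.ne (f.injective h)
    have h3 : ∀ i j, distC4 i j ≤ 2 := by decide
    have h3 := h3 i j
    rw [← dist_eq_one_iff_adj] at h1
    rw [Ne, ← hc.dist_eq_zero_iff] at h2
    omega

/-- The data of an isometric `H₃` in terms of two geodesics of length three. -/
lemma appears_H3 (hc : G.Connected) {P Q : ℕ → V} (hP : IsGeo G P 3) (hQ : IsGeo G Q 3)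
    (h0 : Q 0 = P 0) (h3 : Q 3 = P 3) (h22 : G.Adj (P 2) (Q 2))
    (h11 : 2 ≤ G.dist (P 1) (Q 1)) (h12 : 2 ≤ G.dist (P 1) (Q 2)) (h21 : 2 ≤ G.dist (P 2) (Q 1)) :
    AppearsIsometrically H3 G := by
  have p := fun i j (hij : i ≤ j) (hj : j ≤ 3) => (hP i j hij hj).ge
  have q := fun i j (hij : i ≤ j) (hj : j ≤ 3) => (hQ i j hij hj).ge
  have p' := fun i (hi : i + 1 ≤ 3) => hP.adj hi
  have q' := fun i (hi : i + 1 ≤ 3) => hQ.adj hi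
  have q23 := (q' 2 (by omega)).symm
  have q01 := q' 0 (by omega)
  have q02 := q 0 2 (by omega) (by omega)
  have q13 := q 1 3 (by omega) (by omega)
  rw [dist_comm] at q13
  rw [h3] at q23 q13
  rw [h0] at q01 q02
  exact isDistTable_H3.appearsIsometrically_of_list hc ![P 0, P 1, P 2, P 3, Q 2, Q 1]
    [(0, 2), (0, 3), (0, 4), (1, 3), (1, 4), (1, 5), (2, 5), (3, 5)] (by decide)
    [(0, 1), (1, 2), (2, 3), (3, 4), (4, 5), (0, 5), (2, 4)] (by decide)
    ⟨p' 0 (by omega), p' 1 (by omega), p' 2 (by omega), q23, (q' 1 (by omega)).symm, q01, h22⟩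
    ⟨p 0 2 (by omega) (by omega), p 0 3 (by omega) (by omega), q02, p 1 3 (by omega) (by omega),
      h12, h11, h21, q13⟩

/-- The data of an isometric `H₅` in terms of two geodesics of length four. -/
lemma appears_H5 (hc : G.Connected) {P Q : ℕ → V} (hP : IsGeo G P 4) (hQ : IsGeo G Q 4)
    (h0 : Q 0 = P 0) (h4 : Q 4 = P 4) (h22 : G.Adj (P 2) (Q 2))
    (h11 : 2 ≤ G.dist (P 1) (Q 1)) (h12 : 2 ≤ G.dist (P 1) (Q 2)) (h21 : 2 ≤ G.dist (P 2) (Q 1))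
    (h33 : 2 ≤ G.dist (P 3) (Q 3)) (h32 : 2 ≤ G.dist (P 3) (Q 2)) (h23 : 2 ≤ G.dist (P 2) (Q 3))
    (h13 : 3 ≤ G.dist (P 1) (Q 3)) (h31 : 3 ≤ G.dist (P 3) (Q 1)) :
    AppearsIsometrically H5 G := by
  have p := fun i j (hij : i ≤ j) (hj : j ≤ 4) => (hP i j hij hj).ge
  have q := fun i j (hij : i ≤ j) (hj : j ≤ 4) => (hQ i j hij hj).ge
  have p' := fun i (hi : i + 1 ≤ 4) => hP.adj hi
  have q' := fun i (hi : i + 1 ≤ 4) => hQ.adj hi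
  have r := fun i j (hij : i ≤ j) (hj : j ≤ 4) => (G.dist_comm.trans (hP i j hij hj)).ge
  have t := fun i j (hij : i ≤ j) (hj : j ≤ 4) => (G.dist_comm.trans (hQ i j hij hj)).ge
  have a34 := (q' 3 (by omega)).symm
  have a67 := (q' 0 (by omega)).symm
  have d35 := t 2 4 (by omega) (by omega)
  have d36 := t 1 4 (by omega) (by omega)
  have d47 := t 0 3 (by omega) (by omega)
  have d57 := t 0 2 (by omega) (by omega)
  rw [h4] at a34 d35 d36
  rw [h0] at a67 d47 d57
  exact isDistTable_H5.appearsIsometrically_of_list hc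
    ![P 1, P 2, P 3, P 4, Q 3, Q 2, Q 1, P 0]
    [(0, 2), (0, 3), (0, 4), (0, 5), (0, 6), (1, 3), (1, 4), (1, 6), (1, 7), (2, 4), (2, 5),
      (2, 6), (2, 7), (3, 5), (3, 6), (3, 7), (4, 6), (4, 7), (5, 7)] (by decide)
    [(0, 1), (1, 2), (2, 3), (3, 4), (4, 5), (5, 6), (6, 7), (0, 7), (1, 5)] (by decide)
    ⟨p' 1 (by omega), p' 2 (by omega), p' 3 (by omega), a34, (q' 2 (by omega)).symm,
      (q' 1 (by omega)).symm, a67, (p' 0 (by omega)).symm, h22⟩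
    ⟨p 1 3 (by omega) (by omega), p 1 4 (by omega) (by omega), h13, h12, h11,
      p 2 4 (by omega) (by omega), h23, h21, r 0 2 (by omega) (by omega), h33, h32, h31,
      r 0 3 (by omega) (by omega), d35, d36, r 0 4 (by omega) (by omega),
      t 1 3 (by omega) (by omega), d47, d57⟩

lemma two_le_dist (hc : G.Connected) {x y : V} (hne : x ≠ y) (h : ¬ G.Adj x y) :
    2 ≤ G.dist x y := by
  rw [← dist_eq_one_iff_adj] at h
  rw [Ne, ← hc.dist_eq_zero_iff] at hne
  omega

/-- Take a nearest target `y` violating the property and geodesics through `p` and `q`; by induction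
they are joined only by chords at equal levels. No chord would give an induced cycle of length `2k`.
A first chord at level `s` gives length `2s + 1`, so `s = 2`; a further chord would give an even
cycle. Closing up at `y` gives length `2k - 3`, so `k` is 3 or 4, and these two cases are exactly
`H3` and `H5`. -/
lemma intervalNeighborhoodClique (hc : G.Connected) (hcyc : OnlyShortOddCycles G)
    (h3 : ¬ AppearsIsometrically H3 G) (h5 : ¬ AppearsIsometrically H5 G) :
    IntervalNeighborhoodClique G := by
  intro x y
  induction hk : G.dist x y using Nat.strong_induction_on generalizing y with
  | _ k ih =>
  intro p q hxp hxq hpq hp hq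
  by_contra hnadj
  obtain ⟨P, P0, P1, Pk, hP⟩ := exists_isGeo_through hc hxp (by rw [hk]; exact hp)
  obtain ⟨Q, Q0, Q1, Qk, hQ⟩ := exists_isGeo_through hc hxq (by rw [hk]; exact hq)
  rw [hk] at Pk Qk hP hQ
  have hk2 : 2 ≤ k := by
    by_contra hlt
    have e1 : p = y := hc.dist_eq_zero_iff.1 (by omega)
    have e2 : q = y := hc.dist_eq_zero_iff.1 (by omega)
    exact hpq (e1.trans e2.symm)
  -- A meeting point, or below an oblique chord its farther end, is a target nearer than `y` that is
  -- still approached by both `p` and `q`, so induction would give `p ~ q`.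
  have hne : ∀ i j, 1 ≤ i → i < k → 1 ≤ j → j ≤ k → P i ≠ Q j := by
    intro i j hi hik hj hjk he
    have d1 := hP.dist_zero (i := i) (by omega)
    have d2 := hQ.dist_zero (i := j) (by omega)
    rw [P0] at d1
    rw [Q0, ← he, d1] at d2
    subst d2
    refine hnadj (ih i hik (P i) d1 p q hxp hxq hpq ?_ ?_)
    · rw [← P1, hP 1 i hi (by omega)]; omega
    · rw [← Q1, he, hQ 1 i hi (by omega)]; omega
  have hpar : ∀ i j, 1 ≤ i → i < k → 1 ≤ j → j < k → G.Adj (P i) (Q j) → i = j := by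
    intro i j hi hik hj hjk ha
    have d1 := hP.dist_zero (i := i) (by omega)
    have d2 := hQ.dist_zero (i := j) (by omega)
    rw [P0] at d1
    rw [Q0] at d2
    have e1 := hP 1 i hi (by omega)
    have e2 := hQ 1 j hj (by omega)
    rw [P1] at e1
    rw [Q1] at e2
    have l1 := Adj.le_succ_dist hc ha x
    have l2 := Adj.le_succ_dist hc ha.symm x
    have l3 := Adj.le_succ_dist hc ha q
    have l4 := Adj.le_succ_dist hc ha.symm p
    simp only [G.dist_comm (v := x), G.dist_comm (v := p), G.dist_comm (v := q)] at l1 l2 l3 l4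
    by_contra hij
    rcases lt_or_gt_of_ne hij with hl | hl
    · exact hnadj (ih j hjk (Q j) d2 p q hxp hxq hpq (by omega) (by omega))
    · exact hnadj (ih i hik (P i) d1 p q hxp hxq hpq (by omega) (by omega))
  -- adjacencies and equalities with the common ends
  have hx : ∀ j, 1 ≤ j → j ≤ k → P 0 ≠ Q j ∧ (G.Adj (P 0) (Q j) ↔ j = 1) := by
    intro j hj hjk
    obtain ⟨a, b⟩ := hQ.isIndPath 0 j hj hjk
    rw [P0, ← Q0]
    exact ⟨a, b⟩
  have hy : ∀ j, j < k → P k ≠ Q j ∧ (G.Adj (P k) (Q j) ↔ j + 1 = k) := by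
    intro j hjk
    obtain ⟨a, b⟩ := hQ.isIndPath j k hjk le_rfl
    rw [Pk, ← Qk]
    exact ⟨a.symm, (G.adj_comm _ _).trans (b.trans (by omega))⟩
  -- the first chord
  have hex : ∃ i, 1 ≤ i ∧ i < k ∧ G.Adj (P i) (Q i) := by
    by_contra hno
    push Not at hno
    refine hcyc _ ?_ (hP.cycle hQ (s := 0) (t := k) (s' := 1) (t' := k - 1)
      (by omega) (by omega) (by omega) (by omega) ?_)
    · omega
    · intro i j _ hi hj hj'
      rcases Nat.eq_zero_or_pos i with rfl | hi0
      · exact ⟨(hx j hj (by omega)).1, (hx j hj (by omega)).2.trans (by omega)⟩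
      · rcases hi.eq_or_lt with rfl | hik
        · exact ⟨(hy j (by omega)).1, (hy j (by omega)).2.trans (by omega)⟩
        · refine ⟨hne i j hi0 hik hj (by omega), ?_⟩
          constructor
          · intro ha
            obtain rfl := hpar i j hi0 hik hj (by omega) ha
            exact absurd ha (hno i hi0 hik)
          · omega
  classical
  obtain ⟨hs1, hsk, hsa⟩ := Nat.find_spec hex
  have hsmin : ∀ i, i < Nat.find hex → 1 ≤ i → ¬ G.Adj (P i) (Q i) := by
    intro i hi h1 ha
    exact Nat.find_min hex hi ⟨h1, by omega, ha⟩
  set s := Nat.find hex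
  clear_value s
  have hs2 : 2 ≤ s := by
    by_contra hlt
    obtain rfl : s = 1 := by omega
    rw [P1, Q1] at hsa
    exact hnadj hsa
  have hs : s = 2 := by
    by_contra hs
    refine hcyc _ ?_ (hP.cycle hQ (s := 0) (t := s) (s' := 1) (t' := s)
      (by omega) (by omega) (by omega) (by omega) ?_)
    · omega
    · intro i j _ hi hj hj'
      rcases Nat.eq_zero_or_pos i with rfl | hi0
      · exact ⟨(hx j hj (by omega)).1, (hx j hj (by omega)).2.trans (by omega)⟩
      · refine ⟨hne i j hi0 (by omega) hj (by omega), ?_⟩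
        constructor
        · intro ha
          obtain rfl := hpar i j hi0 (by omega) hj (by omega) ha
          rcases hi.eq_or_lt with rfl | hlt
          · omega
          · exact absurd ha (hsmin i hlt hi0)
        · rintro (⟨rfl, rfl⟩ | ⟨rfl, rfl⟩)
          · exact hsa
          · omega
  subst hs
  -- there is no second chord
  have hno : ∀ i, 2 < i → i < k → ¬ G.Adj (P i) (Q i) := by
    by_contra hno
    push Not at hno
    obtain ⟨ht1, htk, hta⟩ := Nat.find_spec hno
    have htmin : ∀ i, i < Nat.find hno → 2 < i → ¬ G.Adj (P i) (Q i) := by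
      intro i hi h1 ha
      exact Nat.find_min hno hi ⟨h1, by omega, ha⟩
    set t := Nat.find hno
    clear_value t
    refine hcyc _ ?_ (hP.cycle hQ (s := 2) (t := t) (s' := 2) (t' := t)
      (by omega) (by omega) (by omega) (by omega) ?_)
    · omega
    · intro i j hi hi' hj hj'
      refine ⟨hne i j (by omega) (by omega) (by omega) (by omega), ?_⟩
      constructor
      · intro ha
        obtain rfl := hpar i j (by omega) (by omega) (by omega) (by omega) ha
        rcases hi'.eq_or_lt with rfl | hlt
        · omega
        · rcases hi.eq_or_lt with rfl | hlt'
          · omega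
          · exact absurd ha (htmin i hlt hlt')
      · rintro (⟨rfl, rfl⟩ | ⟨rfl, rfl⟩)
        · exact hta
        · exact hsa
  have hk4 : k ≤ 4 := by
    by_contra hk4
    refine hcyc _ ?_ (hP.cycle hQ (s := 2) (t := k) (s' := 2) (t' := k - 1)
      (by omega) (by omega) (by omega) (by omega) ?_)
    · omega
    · intro i j hi hi' hj hj'
      rcases hi'.eq_or_lt with rfl | hik
      · exact ⟨(hy j (by omega)).1, (hy j (by omega)).2.trans (by omega)⟩
      · refine ⟨hne i j (by omega) (by omega) (by omega) (by omega), ?_⟩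
        constructor
        · intro ha
          obtain rfl := hpar i j (by omega) (by omega) (by omega) (by omega) ha
          rcases hi.eq_or_lt with rfl | hlt'
          · omega
          · exact absurd ha (hno i hlt' hik)
        · rintro (⟨rfl, rfl⟩ | ⟨rfl, rfl⟩)
          · omega
          · exact hsa
  have hfar : ∀ i j, 1 ≤ i → i < k → 1 ≤ j → j < k → i ≠ j → 2 ≤ G.dist (P i) (Q j) :=
    fun i j hi hik hj hjk hij => two_le_dist hc (hne i j hi hik hj hjk.le)
      fun ha => hij (hpar i j hi hik hj hjk ha)
  have h11 : 2 ≤ G.dist (P 1) (Q 1) := by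
    rw [P1, Q1]; exact two_le_dist hc hpq hnadj
  have hk34 : k = 3 ∨ k = 4 := by omega
  rcases hk34 with rfl | rfl
  · exact h3 (appears_H3 hc hP hQ (Q0.trans P0.symm) (Qk.trans Pk.symm) hsa h11
      (hfar 1 2 (by omega) (by omega) (by omega) (by omega) (by omega))
      (hfar 2 1 (by omega) (by omega) (by omega) (by omega) (by omega)))
  · refine h5 (appears_H5 hc hP hQ (Q0.trans P0.symm) (Qk.trans Pk.symm) hsa h11
      (hfar 1 2 (by omega) (by omega) (by omega) (by omega) (by omega))
      (hfar 2 1 (by omega) (by omega) (by omega) (by omega) (by omega))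
      (two_le_dist hc (hne 3 3 (by omega) (by omega) (by omega) (by omega))
        (hno 3 (by omega) (by omega)))
      (hfar 3 2 (by omega) (by omega) (by omega) (by omega) (by omega))
      (hfar 2 3 (by omega) (by omega) (by omega) (by omega) (by omega)) ?_ ?_)
    -- If `P 1` were within 2 of `Q 3`, then `Q 3`, at distance 3 from `x`, would be a nearer
    -- target.
    · have d := hQ.dist_zero (i := 3) (by omega)
      have e := hQ 1 3 (by omega) (by omega)
      rw [Q0] at d
      by_contra hlt
      rw [P1] at hlt
      rw [Q1] at e
      exact hnadj (ih 3 (by omega) (Q 3) d p q hxp hxq hpq (by omega) (by omega))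
    · have d := hP.dist_zero (i := 3) (by omega)
      have e := hP 1 3 (by omega) (by omega)
      rw [P0] at d
      by_contra hlt
      rw [Q1, dist_comm] at hlt
      rw [P1] at e
      exact hnadj (ih 3 (by omega) (P 3) d p q hxp hxq hpq (by omega) (by omega))

/-! ### Squares with side length two and a chord between opposite sides -/

lemma isIndContained_of_list {n : ℕ} {H : SimpleGraph (Fin n)} (f : Fin n → V)
    (L : List (Fin n × Fin n)) (hL : ∀ i j, i < j → (i, j) ∈ L ∨ H.Adj i j)
    (L' : List (Fin n × Fin n)) (hL' : ∀ i j, i < j → (i, j) ∈ L' ∨ ¬ H.Adj i j)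
    (hadj : L'.Forall fun p => G.Adj (f p.1) (f p.2))
    (hd : L.Forall fun p => 2 ≤ G.dist (f p.1) (f p.2)) :
    H.IsIndContained G := by
  rw [List.forall_iff_forall_mem] at hadj hd
  have key : ∀ i j, i < j → f i ≠ f j ∧ (G.Adj (f i) (f j) ↔ H.Adj i j) := by
    intro i j hij
    by_cases ha : H.Adj i j
    · have := hadj (i, j) ((hL' i j hij).resolve_right (not_not.2 ha))
      exact ⟨this.ne, iff_of_true this ha⟩
    · have := hd (i, j) ((hL i j hij).resolve_right ha)
      simp only at this
      refine ⟨fun he => ?_, iff_of_false (fun h => ?_) ha⟩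
      · rw [he, dist_self] at this; omega
      · rw [dist_eq_one_iff_adj.2 h] at this; omega
  have hinj : Function.Injective f := by
    intro i j he
    rcases lt_trichotomy i j with hl | hl | hl
    · exact absurd he (key i j hl).1
    · exact hl
    · exact absurd he.symm (key j i hl).1
  refine ⟨⟨⟨f, hinj⟩, ?_⟩⟩
  intro i j
  change G.Adj (f i) (f j) ↔ _
  rcases lt_trichotomy i j with hl | rfl | hl
  · exact (key i j hl).2
  · simp
  · rw [G.adj_comm, H.adj_comm]; exact (key j i hl).2

lemma dist_le_two (hc : G.Connected) {x m y : V} (h1 : G.Adj x m) (h2 : G.Adj m y) :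
    G.dist x y ≤ 2 := by
  have e1 := dist_eq_one_iff_adj.2 h1
  have e2 := dist_eq_one_iff_adj.2 h2
  have t := hc.dist_triangle (u := x) (v := m) (w := y)
  omega

lemma two_le_dist_of_adj (hc : G.Connected) {x m y : V} (h1 : G.Adj y m) (h : 3 ≤ G.dist x m) :
    2 ≤ G.dist x y := by
  have e1 := dist_eq_one_iff_adj.2 h1
  have t := hc.dist_triangle (u := x) (v := y) (w := m)
  omega

/-- A four-cycle without one diagonal has the other one. -/
lemma OnlyShortOddCycles.adj (hc : G.Connected) (h : OnlyShortOddCycles G) {p q r s : V}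
    (pq : G.Adj p q) (qr : G.Adj q r) (rs : G.Adj r s) (sp : G.Adj s p) (pr : 2 ≤ G.dist p r)
    (hqs : q ≠ s) : G.Adj q s := by
  by_contra hn
  exact h 4 (by omega) (isIndContained_of_list ![p, q, r, s] [(0, 2), (1, 3)] (by decide)
    [(0, 1), (1, 2), (2, 3), (0, 3)] (by decide) ⟨pq, qr, rs, sp.symm⟩
    ⟨pr, two_le_dist hc hqs hn⟩)

/-- The eight-cycle `[x a u c y d v b]` with the chord `ad`, where `x`, `y` and `u`, `v` are at
distance three and the sides of the quadrangle `x u y v` have length two. -/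
structure IsSquare (G : SimpleGraph V) (x a u c y d v b : V) : Prop where
  xa : G.Adj x a
  au : G.Adj a u
  uc : G.Adj u c
  cy : G.Adj c y
  yd : G.Adj y d
  dv : G.Adj d v
  vb : G.Adj v b
  bx : G.Adj b x
  ad : G.Adj a d
  xy : 3 ≤ G.dist x y
  uv : 3 ≤ G.dist u v
  xu : 2 ≤ G.dist x u
  uy : 2 ≤ G.dist u y
  yv : 2 ≤ G.dist y v
  vx : 2 ≤ G.dist v x

namespace IsSquare

variable {x a u c y d v b : V}

lemma swap (h : IsSquare G x a u c y d v b) : IsSquare G u a x b v d y c where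
  xa := h.au.symm
  au := h.xa.symm
  uc := h.bx.symm
  cy := h.vb.symm
  yd := h.dv.symm
  dv := h.yd.symm
  vb := h.cy.symm
  bx := h.uc.symm
  ad := h.ad
  xy := h.uv
  uv := h.xy
  xu := by rw [dist_comm]; exact h.xu
  uy := by rw [dist_comm]; exact h.vx
  yv := by rw [dist_comm]; exact h.yv
  vx := by rw [dist_comm]; exact h.uy

lemma flip (h : IsSquare G x a u c y d v b) : IsSquare G v d y c u a x b where
  xa := h.dv.symm
  au := h.yd.symm
  uc := h.cy.symm
  cy := h.uc.symm
  yd := h.au.symm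
  dv := h.xa.symm
  vb := h.bx.symm
  bx := h.vb.symm
  ad := h.ad.symm
  xy := by rw [dist_comm]; exact h.uv
  uv := by rw [dist_comm]; exact h.xy
  xu := by rw [dist_comm]; exact h.yv
  uy := by rw [dist_comm]; exact h.uy
  yv := by rw [dist_comm]; exact h.xu
  vx := by rw [dist_comm]; exact h.vx

variable (hc : G.Connected) (h : IsSquare G x a u c y d v b)
include hc h

lemma xc : 2 ≤ G.dist x c := two_le_dist_of_adj hc h.cy h.xy
lemma xd : 2 ≤ G.dist x d := two_le_dist_of_adj hc h.yd.symm h.xy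
lemma ay : 2 ≤ G.dist a y := by
  rw [dist_comm]; exact two_le_dist_of_adj hc h.xa.symm (by rw [dist_comm]; exact h.xy)
lemma yb : 2 ≤ G.dist y b := two_le_dist_of_adj hc h.bx (by rw [dist_comm]; exact h.xy)
lemma ud : 2 ≤ G.dist u d := h.swap.xd hc
lemma ub : 2 ≤ G.dist u b := h.swap.xc hc
lemma av : 2 ≤ G.dist a v := h.swap.ay hc
lemma cv : 2 ≤ G.dist c v := by rw [dist_comm]; exact h.swap.yb hc
lemma a_ne_b : a ≠ b := by
  rintro rfl
  have := h.ub hc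
  rw [dist_eq_one_iff_adj.2 h.au.symm] at this
  omega
lemma d_ne_b : d ≠ b := h.flip.a_ne_b hc
lemma a_ne_c : a ≠ c := h.swap.a_ne_b hc
lemma d_ne_c : d ≠ c := h.swap.d_ne_b hc

lemma db_of_ab (hcyc : OnlyShortOddCycles G) (ab : G.Adj a b) : G.Adj d b :=
  hcyc.adj hc h.ad h.dv h.vb ab.symm (h.av hc) (h.d_ne_b hc)

lemma appears_H2 (ab : G.Adj a b) (ac : G.Adj a c) (db : G.Adj d b) (dc : G.Adj d c)
    (bc : G.Adj b c) : AppearsIsometrically H2 G :=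
  isDistTable_H2.appearsIsometrically_of_list hc ![x, a, u, c, y, d, v, b]
    [(0, 2), (0, 3), (0, 4), (0, 5), (0, 6), (1, 4), (1, 6), (2, 4), (2, 5), (2, 6), (2, 7),
      (3, 6), (4, 6), (4, 7)] (by decide)
    [(0, 1), (1, 2), (2, 3), (3, 4), (4, 5), (5, 6), (6, 7), (0, 7), (1, 7), (5, 7), (3, 5),
      (1, 3), (1, 5), (3, 7)] (by decide)
    ⟨h.xa, h.au, h.uc, h.cy, h.yd, h.dv, h.vb, h.bx.symm, ab, db, dc.symm, ac, h.ad, bc.symm⟩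
    ⟨h.xu, h.xc hc, h.xy, h.xd hc, G.dist_comm.trans_ge h.vx, h.ay hc, h.av hc, h.uy, h.ud hc,
      h.uv, h.ub hc, h.cv hc, h.yv, h.yb hc⟩

lemma appears_H1 (ab : G.Adj a b) (ac : G.Adj a c) (db : G.Adj d b) (dc : G.Adj d c)
    (bc : 2 ≤ G.dist c b) : AppearsIsometrically H1 G :=
  isDistTable_H1.appearsIsometrically_of_list hc ![x, a, u, c, y, d, v, b]
    [(0, 2), (0, 3), (0, 4), (0, 5), (0, 6), (1, 4), (1, 6), (2, 4), (2, 5), (2, 6), (2, 7),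
      (3, 6), (4, 6), (4, 7), (3, 7)] (by decide)
    [(0, 1), (1, 2), (2, 3), (3, 4), (4, 5), (5, 6), (6, 7), (0, 7), (1, 7), (5, 7), (3, 5),
      (1, 3), (1, 5)] (by decide)
    ⟨h.xa, h.au, h.uc, h.cy, h.yd, h.dv, h.vb, h.bx.symm, ab, db, dc.symm, ac, h.ad⟩
    ⟨h.xu, h.xc hc, h.xy, h.xd hc, G.dist_comm.trans_ge h.vx, h.ay hc, h.av hc, h.uy, h.ud hc,
      h.uv, h.ub hc, h.cv hc, h.yv, h.yb hc, bc⟩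

lemma b_ne_c : b ≠ c := by
  rintro rfl
  have := h.xc hc
  rw [dist_eq_one_iff_adj.2 h.bx.symm] at this
  omega

/-- Any one of the chords `ab`, `ac`, `db`, `dc` propagates to the others through four-cycles with a
missing diagonal. If all four are absent, an induced six-cycle remains. -/
lemma appears_H2_of_bc (hcyc : OnlyShortOddCycles G) (bc : G.Adj b c) :
    AppearsIsometrically H2 G := by
  have ac : G.Adj a c := by
    by_contra hac
    have hab : ¬ G.Adj a b := fun hab =>
      hac (hcyc.adj hc h.au.symm hab bc h.uc.symm (h.ub hc) (h.a_ne_c hc))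
    have hdc : ¬ G.Adj d c := fun hdc =>
      hac (hcyc.adj hc h.au.symm h.ad hdc h.uc.symm (h.ud hc) (h.a_ne_c hc))
    have hdb : ¬ G.Adj d b := fun hdb => hdc
      (hcyc.adj hc h.yd hdb bc h.cy (h.yb hc) (h.d_ne_c hc))
    exact hcyc 6 (by omega) (isIndContained_of_list ![u, a, d, v, b, c]
      [(0, 2), (0, 3), (0, 4), (1, 3), (1, 4), (1, 5), (2, 4), (2, 5), (3, 5)] (by decide)
      [(0, 1), (1, 2), (2, 3), (3, 4), (4, 5), (0, 5)] (by decide)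
      ⟨h.au.symm, h.ad, h.dv, h.vb, bc, h.uc⟩
      ⟨h.ud hc, le_trans (by omega) h.uv, h.ub hc, h.av hc, two_le_dist hc (h.a_ne_b hc) hab,
        two_le_dist hc (h.a_ne_c hc) hac, two_le_dist hc (h.d_ne_b hc) hdb,
        two_le_dist hc (h.d_ne_c hc) hdc, G.dist_comm.trans_ge (h.cv hc)⟩)
  have ab : G.Adj a b := hcyc.adj hc h.xa ac bc.symm h.bx (h.xc hc) (h.a_ne_b hc)
  have db := h.db_of_ab hc hcyc ab
  have dc := h.swap.db_of_ab hc hcyc ac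
  exact h.appears_H2 hc ab ac db dc bc

omit hc in
lemma replace {b' : V} (vb : G.Adj v b') (bx : G.Adj b' x) : IsSquare G x a u c y d v b' :=
  { h with vb := vb, bx := bx }

/-- If `ab` is not an edge, then `b` is far from `y`. -/
lemma yb_of_not_ab (hq : IntervalNeighborhoodClique G) (hab : ¬ G.Adj a b) :
    3 ≤ G.dist b y := by
  by_contra hlt
  have h1 := dist_le_two hc h.ad h.yd.symm
  exact hab (hq x y a b h.xa h.bx.symm (h.a_ne_b hc) (by have := h.xy; omega)
    (by have := h.xy; omega))

lemma ab_of_db (hcyc : OnlyShortOddCycles G) (hdb : G.Adj d b) : G.Adj a b :=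
  h.flip.db_of_ab hc hcyc hdb

lemma ub_of_not_ab (hcyc : OnlyShortOddCycles G) (hq : IntervalNeighborhoodClique G)
    (hab : ¬ G.Adj a b) : 3 ≤ G.dist b u :=
  h.flip.yb_of_not_ab hc hq fun hdb => hab (h.ab_of_db hc hcyc hdb)

/-- If `ab` is not an edge, a common neighbour `m` of `b` and a vertex at distance one from `y` is
adjacent to `v`. -/
lemma adj_v_of_near (hq : IntervalNeighborhoodClique G) (hab : ¬ G.Adj a b) {m : V}
    (bm : G.Adj b m) (my : G.dist m y ≤ 2) (hm : v ≠ m) : G.Adj v m := by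
  have h3 := h.yb_of_not_ab hc hq hab
  have h1 := dist_le_two hc h.dv.symm h.yd.symm
  exact hq b y v m h.vb.symm bm hm (by omega) (by omega)

/-- The clique property keeps `b` and `c` within distance 2 and makes the midpoint between them
adjacent to `v` and `x`. This midpoint can replace `b`, which produces the edge needed for
`appears_H2_of_bc`. -/
lemma appears_H2_of_not_ab_of_ac (hcyc : OnlyShortOddCycles G)
    (hq : IntervalNeighborhoodClique G) (hab : ¬ G.Adj a b) (ac : G.Adj a c) :
    AppearsIsometrically H2 G := by
  have dc := h.swap.db_of_ab hc hcyc ac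
  by_cases hbc : G.Adj b c
  · exact h.appears_H2_of_bc hc hcyc hbc
  have hvx := h.vx
  have h2 : G.dist b c ≤ 2 := by
    by_contra hlt
    have e1 := dist_le_two hc h.xa ac
    have e2 := dist_le_two hc h.dv.symm dc
    have := hq b c x v h.bx h.vb.symm (by rintro rfl; simp at hvx) (by omega) (by omega)
    rw [dist_eq_one_iff_adj.2 this.symm] at hvx
    omega
  have h2' := two_le_dist hc (h.b_ne_c hc) hbc
  obtain ⟨f, f0, f2, hf⟩ := exists_isGeo hc b c
  rw [show G.dist b c = 2 by omega] at f2 hf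
  have bm := hf.adj (i := 0) (by omega)
  have mc := hf.adj (i := 1) (by omega)
  simp only [zero_add, Nat.reduceAdd] at bm mc
  rw [f0] at bm
  rw [f2] at mc
  have hv : v ≠ f 1 := by
    intro he
    have := h.cv hc
    rw [dist_comm, he, dist_eq_one_iff_adj.2 mc] at this
    omega
  have hx : x ≠ f 1 := by
    intro he
    have := h.xc hc
    rw [he, dist_eq_one_iff_adj.2 mc] at this
    omega
  have vm := h.adj_v_of_near hc hq hab bm (dist_le_two hc mc h.cy) hv
  have xm := h.flip.adj_v_of_near hc hq (fun hdb => hab (h.ab_of_db hc hcyc hdb)) bm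
    (dist_le_two hc mc h.uc.symm) hx
  exact (h.replace vm xm.symm).appears_H2_of_bc hc hcyc mc

/-- The neighbour `m` of `b` on a path `b m m' c` is adjacent to `x`. -/
lemma mx_of_path (hcyc : OnlyShortOddCycles G) (hq : IntervalNeighborhoodClique G)
    (hab : ¬ G.Adj a b) (hac : ¬ G.Adj a c) (hbc : G.dist b c = 3) {m m' : V} (bm : G.Adj b m)
    (mm' : G.Adj m m') (mc : G.Adj m' c) : G.Adj m x := by
  have hbu := h.ub_of_not_ab hc hcyc hq hab
  have hcx := h.swap.ub_of_not_ab hc hcyc hq hac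
  have hmc : 2 ≤ G.dist m c := by
    by_contra hlt
    have := Adj.le_succ_dist hc bm c
    omega
  have hbm' : 2 ≤ G.dist b m' := by
    by_contra hlt
    have := Adj.le_succ_dist hc mc b
    have := Adj.le_succ_dist hc mc.symm b
    rw [G.dist_comm (v := b), G.dist_comm (v := b)] at this
    omega
  have hxm : x ≠ m := by
    rintro rfl
    have := dist_le_two hc mm' mc
    rw [dist_comm] at this
    omega
  have hum' : u ≠ m' := by
    rintro rfl
    have := dist_le_two hc bm mm'
    omega
  have hmu : 2 ≤ G.dist m u := by
    by_contra hlt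
    have := Adj.le_succ_dist hc bm u
    omega
  have hm'x : 2 ≤ G.dist m' x := by
    by_contra hlt
    have := Adj.le_succ_dist hc mc.symm x
    omega
  by_contra hmx
  have ham : a ≠ m := by rintro rfl; exact hab bm.symm
  have ham' : a ≠ m' := by rintro rfl; exact hac mc
  have nam : ¬ G.Adj a m := fun am => hmx
    (hcyc.adj hc h.bx h.xa am bm.symm
      (by rw [dist_comm]; exact two_le_dist hc (h.a_ne_b hc) hab) hxm).symm
  have num' : ¬ G.Adj u m' := by
    intro hum
    have e1 := dist_le_two hc mm' hum.symm
    have e2 := dist_le_two hc h.xa h.au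
    exact hmx (hq b u x m h.bx bm hxm (by omega) (by omega)).symm
  have nam' : ¬ G.Adj a m' := fun am => num'
    (hcyc.adj hc h.uc.symm h.au.symm am mc
      (by rw [dist_comm]; exact two_le_dist hc (h.a_ne_c hc) hac) hum')
  -- With `m` not adjacent to `x`, none of `am`, `um'`, `am'` can be an edge, so the closed path
  -- along both sides at `a` is induced.
  exact hcyc 7 (by omega) (isIndContained_of_list ![b, m, m', c, u, a, x]
    [(0, 2), (0, 3), (0, 4), (0, 5), (1, 3), (1, 4), (1, 5), (1, 6), (2, 4), (2, 5), (2, 6),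
      (3, 5), (3, 6), (4, 6)] (by decide)
    [(0, 1), (1, 2), (2, 3), (3, 4), (4, 5), (5, 6), (0, 6)] (by decide)
    ⟨bm, mm', mc, h.uc.symm, h.au.symm, h.xa.symm, h.bx⟩
    ⟨hbm', le_trans (by omega) hbc.ge, le_trans (by omega) hbu,
      G.dist_comm.trans_ge (two_le_dist hc (h.a_ne_b hc) hab), hmc, hmu,
      G.dist_comm.trans_ge (two_le_dist hc ham nam), two_le_dist hc hxm.symm hmx,
      G.dist_comm.trans_ge (two_le_dist hc hum' num'),
      G.dist_comm.trans_ge (two_le_dist hc ham' nam'), hm'x,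
      G.dist_comm.trans_ge (two_le_dist hc (h.a_ne_c hc) hac), le_trans (by omega) hcx,
      G.dist_comm.trans_ge h.xu⟩)

/-- Here `b` and `c` are within distance 3. A midpoint at distance 2 would be adjacent to both `u`
and `v`, which are too far apart. On a path `b m m' c` the inner vertices can replace `b` and `c`.
-/
lemma appears_H2_of_not_ab_of_not_ac (hcyc : OnlyShortOddCycles G)
    (hq : IntervalNeighborhoodClique G) (hab : ¬ G.Adj a b) (hac : ¬ G.Adj a c) :
    AppearsIsometrically H2 G := by
  have hdb : ¬ G.Adj d b := fun hdb => hab (h.ab_of_db hc hcyc hdb)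
  have hdc : ¬ G.Adj d c := fun hdc => hac (h.swap.ab_of_db hc hcyc hdc)
  by_cases hbc : G.Adj b c
  · exact h.appears_H2_of_bc hc hcyc hbc
  have hvx := h.vx
  have h3 : G.dist b c ≤ 3 := by
    by_contra hlt
    have e1 := dist_le_two hc h.au h.uc
    have e2 := dist_le_two hc h.yd.symm h.cy.symm
    have e3 := Adj.le_succ_dist hc h.xa c
    have e4 := Adj.le_succ_dist hc h.dv.symm c
    have := hq b c x v h.bx h.vb.symm (by rintro rfl; simp at hvx) (by omega) (by omega)
    rw [dist_eq_one_iff_adj.2 this.symm] at hvx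
    omega
  have h2' := two_le_dist hc (h.b_ne_c hc) hbc
  obtain ⟨f, f0, f2, hf⟩ := exists_isGeo hc b c
  have bm := hf.adj (i := 0) (by omega)
  have mm' := hf.adj (i := 1) (by omega)
  simp only [zero_add, Nat.reduceAdd] at bm mm'
  rw [f0] at bm
  have h23 : G.dist b c = 2 ∨ G.dist b c = 3 := by omega
  rcases h23 with h2 | h3
  · rw [h2] at f2
    rw [f2] at mm'
    have hv : v ≠ f 1 := by
      intro he
      have := h.cv hc
      rw [dist_comm, he, dist_eq_one_iff_adj.2 mm'] at this
      omega
    have hu : u ≠ f 1 := by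
      intro he
      have := h.ub hc
      rw [dist_comm, he, dist_eq_one_iff_adj.2 bm] at this
      omega
    have vm := h.adj_v_of_near hc hq hab bm (dist_le_two hc mm' h.cy) hv
    have um := h.swap.flip.adj_v_of_near hc hq hdc mm'.symm
      (dist_le_two hc bm.symm h.bx) hu
    have := dist_le_two hc um vm.symm
    have := h.uv
    omega
  · have mc := hf.adj (i := 2) (by omega)
    simp only [Nat.reduceAdd] at mc
    rw [h3] at f2
    rw [f2] at mc
    have h3' : G.dist c b = 3 := by rw [dist_comm]; exact h3
    have hmx := h.mx_of_path hc hcyc hq hab hac h3 bm mm' mc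
    have hmv := h.flip.mx_of_path hc hcyc hq hdb hdc h3 bm mm' mc
    have hmu := h.swap.mx_of_path hc hcyc hq hac hab h3' mc.symm mm'.symm bm.symm
    have hmy := h.flip.swap.mx_of_path hc hcyc hq hdc hdb h3' mc.symm mm'.symm bm.symm
    exact ((h.replace hmv.symm hmx).swap.replace hmy.symm hmu).swap.appears_H2_of_bc hc hcyc mm'

lemma appears (hcyc : OnlyShortOddCycles G) (hq : IntervalNeighborhoodClique G) :
    AppearsIsometrically H1 G ∨ AppearsIsometrically H2 G := by
  by_cases hab : G.Adj a b
  · by_cases hac : G.Adj a c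
    · by_cases hbc : G.Adj b c
      · exact Or.inr (h.appears_H2_of_bc hc hcyc hbc)
      · exact Or.inl (h.appears_H1 hc hab hac (h.db_of_ab hc hcyc hab)
          (h.swap.db_of_ab hc hcyc hac)
          (two_le_dist hc (h.b_ne_c hc).symm fun hcb => hbc hcb.symm))
    · exact Or.inr (h.swap.appears_H2_of_not_ab_of_ac hc hcyc hq hac hab)
  · by_cases hac : G.Adj a c
    · exact Or.inr (h.appears_H2_of_not_ab_of_ac hc hcyc hq hab hac)
    · exact Or.inr (h.appears_H2_of_not_ab_of_not_ac hc hcyc hq hab hac)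

end IsSquare

/-! ### Minimal gap quadruples -/

/-- A gap quadruple of least perimeter. -/
structure MinGap (G : SimpleGraph V) (k : ℕ) (x u y v : V) : Prop where
  gap : Gap G k x u y v
  min : ∀ x' u' y' v', Gap G k x' u' y' v' →
    G.dist x u + G.dist u y + G.dist y v + G.dist v x ≤
      G.dist x' u' + G.dist u' y' + G.dist y' v' + G.dist v' x'

lemma exists_minGap {k : ℕ} (h : ∃ x u y v, Gap G k x u y v) : ∃ x u y v, MinGap G k x u y v := by
  classical
  have hex : ∃ n x u y v, Gap G k x u y v ∧
      G.dist x u + G.dist u y + G.dist y v + G.dist v x = n := by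
    obtain ⟨x, u, y, v, hg⟩ := h
    exact ⟨_, x, u, y, v, hg, rfl⟩
  obtain ⟨x, u, y, v, hg, hn⟩ := Nat.find_spec hex
  exact ⟨x, u, y, v, hg, fun x' u' y' v' hg' =>
    hn.le.trans (Nat.find_min' hex ⟨x', u', y', v', hg', rfl⟩)⟩

namespace Gap

variable {k : ℕ} {x u y v : V}

lemma rotate (h : Gap G k x u y v) : Gap G k u y v x := by
  obtain ⟨h1, h2⟩ := h
  rw [dist_comm (u := x) (v := v)] at h2
  rw [dist_comm (u := x) (v := u), dist_comm (u := x) (v := y)] at h1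
  rw [dist_comm (u := x) (v := y)] at h2
  exact ⟨by omega, by omega⟩

end Gap

namespace MinGap

variable {k : ℕ} {x u y v : V}

lemma rotate (h : MinGap G k x u y v) : MinGap G k u y v x :=
  ⟨h.gap.rotate, fun x' u' y' v' hg => by have := h.min x' u' y' v' hg; omega⟩

/-- Moving `x` to `p` lowers both side sums by `d(x,p)` and the diagonal sum by at most that much.
The gap survives while the perimeter drops by `2 d(x,p)`. -/
lemma corner (hc : G.Connected) (h : MinGap G k x u y v) {p : V}
    (h1 : G.dist x p + G.dist p v = G.dist x v) (h2 : G.dist x p + G.dist p u = G.dist x u) :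
    p = x := by
  have t := hc.dist_triangle (u := x) (v := p) (w := y)
  obtain ⟨g1, g2⟩ := h.gap
  have hg : Gap G k p u y v := ⟨by omega, by omega⟩
  have := h.min p u y v hg
  rw [dist_comm (u := v) (v := x), dist_comm (u := v) (v := p)] at this
  exact (hc.dist_eq_zero_iff.1 (by omega : G.dist x p = 0)).symm

lemma side_pos (hc : G.Connected) (h : MinGap G k x u y v) (hk : 1 ≤ k) : 1 ≤ G.dist x u := by
  by_contra hlt
  obtain rfl := hc.dist_eq_zero_iff.1 (by omega : G.dist x u = 0)
  obtain ⟨g1, g2⟩ := h.gap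
  omega

end MinGap

/-! ### Sides, corners and their chords -/

/-- `P 0, …, P a` is a geodesic from `x` to `u`. -/
structure Side (G : SimpleGraph V) (x u : V) (P : ℕ → V) (a : ℕ) : Prop where
  first : P 0 = x
  last : P a = u
  geo : IsGeo G P a

namespace Side

variable {x u y : V} {P Q : ℕ → V} {a e r : ℕ}

lemma dist_first (h : Side G x u P a) {i : ℕ} (hi : i ≤ a) : G.dist x (P i) = i := by
  rw [← h.first]; exact h.geo.dist_zero hi

lemma dist_last (h : Side G x u P a) {i : ℕ} (hi : i ≤ a) : G.dist (P i) u = a - i := by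
  rw [← h.last]; exact h.geo.dist_last hi

lemma dist_eq (h : Side G x u P a) : G.dist x u = a := by
  rw [← h.last]; exact h.dist_first le_rfl

lemma symm (h : Side G x u P a) : Side G u x (fun i => P (a - i)) a :=
  ⟨by simpa using h.last, by simpa using h.first, h.geo.reverse⟩

lemma take (h : Side G x u P a) {i : ℕ} (hi : i ≤ a) : Side G x (P i) P i :=
  ⟨h.first, rfl, h.geo.mono hi⟩

lemma drop (h : Side G x u P a) {i : ℕ} (hi : i ≤ a) :
    Side G (P i) u (fun t => P (i + t)) (a - i) :=
  ⟨rfl, by rw [Nat.add_sub_cancel' hi]; exact h.last, h.geo.shift i (by omega)⟩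

end Side

lemma exists_side (hc : G.Connected) (x u : V) : ∃ P, Side G x u P (G.dist x u) := by
  obtain ⟨P, h0, h1, h⟩ := exists_isGeo hc x u
  exact ⟨P, h0, h1, h⟩

/-- Two geodesics `x → u → y` form a corner at `u`: only `u` lies between `u` and both `x`
and `y`. -/
structure Corner (G : SimpleGraph V) (x u y : V) (P : ℕ → V) (a : ℕ) (Q : ℕ → V) (e : ℕ) :
    Prop where
  left : Side G x u P a
  right : Side G u y Q e
  only : ∀ p, G.dist u p + G.dist p x = G.dist u x → G.dist u p + G.dist p y = G.dist u y → p = u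

/-- `r` is the level of the last chord of the corner between `P` and `Q`, or `0` if there is
none. -/
structure LastChord (G : SimpleGraph V) (P : ℕ → V) (a : ℕ) (Q : ℕ → V) (e r : ℕ) : Prop where
  le_left : r ≤ a
  le_right : r ≤ e
  adj : 1 ≤ r → G.Adj (P (a - r)) (Q r)
  last : ∀ i, r < i → i ≤ a → i ≤ e → ¬ G.Adj (P (a - i)) (Q i)

lemma exists_lastChord (G : SimpleGraph V) (P : ℕ → V) (a : ℕ) (Q : ℕ → V) (e : ℕ) :
    ∃ r, LastChord G P a Q e r := by
  classical
  let p : ℕ → Prop := fun i => G.Adj (P (a - i)) (Q i)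
  have hle := Nat.findGreatest_le (P := p) (min a e)
  refine ⟨Nat.findGreatest p (min a e), by omega, by omega, fun h => ?_, fun i hi h1 h2 => ?_⟩
  · exact Nat.findGreatest_of_ne_zero (P := p) rfl (by omega)
  · exact Nat.findGreatest_is_greatest (P := p) hi (by omega)

namespace Corner

variable {x u y : V} {P Q : ℕ → V} {a e r : ℕ}

lemma symm (h : Corner G x u y P a Q e) :
    Corner G y u x (fun i => Q (e - i)) e (fun i => P (a - i)) a :=
  ⟨h.right.symm, h.left.symm, fun p h1 h2 => h.only p h2 h1⟩

lemma ne (h : Corner G x u y P a Q e) {i j : ℕ} (hi : i < a) (hj : j ≤ e) :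
    P i ≠ Q j := by
  intro he
  have d1 := h.left.dist_last hi.le
  have d2 := h.left.dist_first hi.le
  have d3 := h.right.dist_first hj
  have d4 := h.right.dist_last hj
  have d5 := h.left.dist_eq
  have d6 := h.right.dist_eq
  rw [dist_comm] at d2 d5 d1
  rw [← he] at d3 d4
  have := h.only (P i) (by omega) (by omega)
  rw [this, dist_self] at d1
  omega

/-- If the ends of a chord had different distances from `u`, the nearer one would lie between `u`
and both `x` and `y`. -/
lemma eq_of_adj (hc : G.Connected) (h : Corner G x u y P a Q e) {i j : ℕ} (hi : i < a)
    (hj : 1 ≤ j) (hj' : j ≤ e) (ha : G.Adj (P i) (Q j)) : i + j = a := by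
  have d1 := h.left.dist_last hi.le
  have d2 := h.left.dist_first hi.le
  have d3 := h.right.dist_first hj'
  have d4 := h.right.dist_last hj'
  have d5 := h.left.dist_eq
  have d6 := h.right.dist_eq
  have l1 := Adj.le_succ_dist hc ha u
  have l2 := Adj.le_succ_dist hc ha.symm u
  have l3 := Adj.le_succ_dist hc ha y
  have l4 := Adj.le_succ_dist hc ha.symm x
  have t1 := hc.dist_triangle (u := u) (v := P i) (w := y)
  have t2 := hc.dist_triangle (u := u) (v := Q j) (w := x)
  rw [dist_comm] at d2 d5
  rw [dist_comm] at d3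
  have c1 := G.dist_comm (u := P i) (v := u)
  have c2 := G.dist_comm (u := Q j) (v := u)
  by_contra hne
  rcases lt_or_gt_of_ne hne with hl | hl
  · have := h.only (Q j) (by omega) (by omega)
    rw [this, dist_self] at d3
    omega
  · have := h.only (P i) (by omega) (by omega)
    rw [this, dist_self] at d1
    omega

/-- Without a chord the first side still contains `u`, so the second starts at `Q 1`; hence `max r
1`. The only link is the last chord or, failing that, the edge at `u`. -/
lemma cross (hc : G.Connected) (h : Corner G x u y P a Q e) (hr : LastChord G P a Q e r)
    {i j : ℕ} (hi : i ≤ a - r) (hj : max r 1 ≤ j) (hj' : j ≤ e) :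
    P i ≠ Q j ∧ (G.Adj (P i) (Q j) ↔ i = a - r ∧ j = max r 1) := by
  have hra := hr.le_left
  rcases (show i ≤ a by omega).lt_or_eq with hlt | rfl
  · refine ⟨h.ne hlt hj', fun ha => ?_, ?_⟩
    · have hij := h.eq_of_adj hc hlt (by omega) hj' ha
      have hjr : ¬ r < j := by
        intro hrj
        refine hr.last j hrj (by omega) hj' ?_
        rwa [show a - j = i by omega]
      omega
    · rintro ⟨rfl, rfl⟩
      have h1 : 1 ≤ r := by omega
      rw [max_eq_left h1]
      exact hr.adj h1
  · have := h.right.geo.isIndPath 0 j (by omega) hj'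
    rw [h.right.first, ← h.left.last] at this
    exact ⟨this.1, this.2.trans (by omega)⟩

lemma route (hc : G.Connected) (h : Corner G x u y P a Q e) (hr : LastChord G P a Q e r)
    {i j : ℕ} (hi : i ≤ a - r) (hj : r ≤ j) (hj' : j ≤ e) :
    G.dist (P i) (Q j) ≤ (a - r - i) + min r 1 + (j - r) := by
  have hra := hr.le_left
  have d1 := h.left.geo i (a - r) hi (by omega)
  have d2 := h.right.geo r j hj hj'
  have d3 : G.dist (P (a - r)) (Q r) ≤ min r 1 := by
    rcases Nat.eq_zero_or_pos r with rfl | hpos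
    · rw [Nat.sub_zero, h.left.last, h.right.first, dist_self]; omega
    · rw [dist_eq_one_iff_adj.2 (hr.adj hpos)]; omega
  have t1 := hc.dist_triangle (u := P i) (v := P (a - r)) (w := Q j)
  have t2 := hc.dist_triangle (u := P (a - r)) (v := Q r) (w := Q j)
  omega

/-- At a corner without chords, the two neighbours of `u` are not both closer to `w` than `u`. -/
lemma not_both_closer (h : Corner G x u y P a Q e) (hr : LastChord G P a Q e 0)
    (hq : IntervalNeighborhoodClique G) (ha : 1 ≤ a) (he : 1 ≤ e) {w : V}
    (h1 : G.dist (P (a - 1)) w + 1 ≤ G.dist u w) (h2 : G.dist (Q 1) w + 1 ≤ G.dist u w) :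
    False := by
  have a1 := h.left.geo.adj (i := a - 1) (by omega)
  rw [Nat.sub_add_cancel ha, h.left.last] at a1
  have a2 := h.right.geo.adj (i := 0) (by omega)
  rw [h.right.first] at a2
  exact hr.last 1 (by omega) ha he
    (hq u w _ _ a1.symm a2 (h.ne (by omega) he) h1 h2)

end Corner

/-! ### Cutting the corners of a quadrangle -/

/-- A quadrangle of geodesics `x → u → y → v → x` of a gap quadruple, with the last chords of its
corners, where opposite sides have no adjacencies besides common sides. -/
structure Frame (G : SimpleGraph V) (k : ℕ) (x u y v : V) (P₁ P₂ P₃ P₄ : ℕ → V)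
    (a e b c rx ru ry rv : ℕ) : Prop where
  gap : Gap G k x u y v
  cu : Corner G x u y P₁ a P₂ e
  cy : Corner G u y v P₂ e P₃ b
  cv : Corner G y v x P₃ b P₄ c
  cx : Corner G v x u P₄ c P₁ a
  lu : LastChord G P₁ a P₂ e ru
  ly : LastChord G P₂ e P₃ b ry
  lv : LastChord G P₃ b P₄ c rv
  lx : LastChord G P₄ c P₁ a rx
  opp₁ : ∀ i j, i ≤ a → j ≤ b → P₁ i ≠ P₃ j ∧
    (G.Adj (P₁ i) (P₃ j) → (i = a ∧ j = 0) ∨ (i = 0 ∧ j = b))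
  opp₂ : ∀ i j, i ≤ e → j ≤ c → P₂ i ≠ P₄ j ∧
    (G.Adj (P₂ i) (P₄ j) → (i = e ∧ j = 0) ∨ (i = 0 ∧ j = c))
  ha : 1 ≤ a
  he : 1 ≤ e
  hb : 1 ≤ b
  hc : 1 ≤ c

namespace Frame

variable {k : ℕ} {x u y v : V} {P₁ P₂ P₃ P₄ : ℕ → V} {a e b c rx ru ry rv : ℕ}

lemma rotate (h : Frame G k x u y v P₁ P₂ P₃ P₄ a e b c rx ru ry rv) :
    Frame G k u y v x P₂ P₃ P₄ P₁ e b c a ru ry rv rx where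
  gap := h.gap.rotate
  cu := h.cy
  cy := h.cv
  cv := h.cx
  cx := h.cu
  lu := h.ly
  ly := h.lv
  lv := h.lx
  lx := h.lu
  opp₁ := h.opp₂
  opp₂ := fun i j hi hj => ⟨(h.opp₁ j i hj hi).1.symm, fun ha => by
    have := (h.opp₁ j i hj hi).2 ha.symm
    omega⟩
  ha := h.he
  he := h.hb
  hb := h.hc
  hc := h.ha

variable (hconn : G.Connected) (h : Frame G k x u y v P₁ P₂ P₃ P₄ a e b c rx ru ry rv)
include hconn h

-- A chord at the far end of a side would join opposite sides, because that end also belongs to the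
-- next side.
omit hconn in
lemma ru_lt : ru < a ∧ ru < e := by
  have h1 := h.lu.le_left
  have h2 := h.lu.le_right
  have ha := h.ha
  have he := h.he
  have hb := h.hb
  have hc := h.hc
  constructor
  · by_contra hlt
    obtain rfl : ru = a := by omega
    have hadj := h.lu.adj ha
    rw [Nat.sub_self, h.cu.left.first, ← h.cx.left.last] at hadj
    have := (h.opp₂ ru c h2 le_rfl).2 hadj.symm
    omega
  · by_contra hlt
    obtain rfl : ru = e := by omega
    have hadj := h.lu.adj he
    rw [h.cu.right.last, ← h.cy.right.first] at hadj
    have := (h.opp₁ (a - ru) 0 (by omega) (by omega)).2 hadj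
    omega

lemma dist_le : G.dist x y ≤ (a - ru) + min ru 1 + (e - ru) := by
  have := h.cu.route hconn h.lu (i := 0) (j := e) (by omega) h.lu.le_right le_rfl
  rw [h.cu.left.first, h.cu.right.last] at this
  omega

/-- Deep cuts at both ends of a side shorten the routes for both diagonals; overlapping cuts would
make the diagonal sum too small for the gap. -/
lemma overlap (hk : 2 ≤ k) : rx + ru ≤ a := by
  have h1 := h.dist_le hconn
  have h2 := h.rotate.rotate.rotate.dist_le hconn
  have g := h.gap.2
  have d1 := h.cx.left.dist_eq
  have d2 := h.cu.right.dist_eq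
  rw [dist_comm] at d1
  rw [dist_comm] at h2
  have := h.ru_lt
  have := h.rotate.rotate.rotate.ru_lt
  omega

/-- Cutting off the corners leaves an induced cycle. -/
lemma cycle (hk : 2 ≤ k) :
    (cycleGraph ((a - ru - max rx 1) + (e - ry - max ru 1) + (b - rv - max ry 1)
      + (c - rx - max rv 1) + 4)).IsIndContained G := by
  have o1 := h.overlap hconn hk
  have o2 := h.rotate.overlap hconn hk
  have o3 := h.rotate.rotate.overlap hconn hk
  have o4 := h.rotate.rotate.rotate.overlap hconn hk
  have l1 := h.ru_lt
  have l2 := h.rotate.ru_lt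
  have l3 := h.rotate.rotate.ru_lt
  have l4 := h.rotate.rotate.rotate.ru_lt
  have p1 := (h.cu.left.geo.shift (max rx 1) (m := a - ru - max rx 1) (by omega)).isIndPath
  have p2 := (h.cy.left.geo.shift (max ru 1) (m := e - ry - max ru 1) (by omega)).isIndPath
  have p3 := (h.cv.left.geo.shift (max ry 1) (m := b - rv - max ry 1) (by omega)).isIndPath
  have p4 := (h.cx.left.geo.shift (max rv 1) (m := c - rx - max rv 1) (by omega)).isIndPath
  have q1 := p1.glue p2 (fun i j hi hj => by
    obtain ⟨n, m⟩ := h.cu.cross hconn h.lu (i := max rx 1 + i) (j := max ru 1 + j)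
      (by omega) (by omega) (by omega)
    exact ⟨n, m.trans (by omega)⟩)
  have q2 := p3.glue p4 (fun i j hi hj => by
    obtain ⟨n, m⟩ := h.cv.cross hconn h.lv (i := max ry 1 + i) (j := max rv 1 + j)
      (by omega) (by omega) (by omega)
    exact ⟨n, m.trans (by omega)⟩)
  have := q1.cycle q2 (fun i j hi hj => by
    by_cases hi' : i ≤ a - ru - max rx 1
    · rw [glue_left hi']
      by_cases hj' : j ≤ b - rv - max ry 1
      · rw [glue_left hj']
        obtain ⟨n, m⟩ := h.opp₁ (max rx 1 + i) (max ry 1 + j) (by omega) (by omega)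
        exact ⟨n, fun ha => by have := m ha; omega, by omega⟩
      · rw [glue_right hj']
        obtain ⟨n, m⟩ := h.cx.cross hconn h.lx
          (i := max rv 1 + (j - (b - rv - max ry 1 + 1))) (j := max rx 1 + i)
          (by omega) (by omega) (by omega)
        exact ⟨n.symm, (G.adj_comm _ _).trans (m.trans (by omega))⟩
    · rw [glue_right hi']
      by_cases hj' : j ≤ b - rv - max ry 1
      · rw [glue_left hj']
        obtain ⟨n, m⟩ := h.cy.cross hconn h.ly
          (i := max ru 1 + (i - (a - ru - max rx 1 + 1))) (j := max ry 1 + j)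
          (by omega) (by omega) (by omega)
        exact ⟨n, m.trans (by omega)⟩
      · rw [glue_right hj']
        obtain ⟨n, m⟩ := h.opp₂ (max ru 1 + (i - (a - ru - max rx 1 + 1)))
          (max rv 1 + (j - (b - rv - max ry 1 + 1))) (by omega) (by omega)
        exact ⟨n, fun ha => by have := m ha; omega, by omega⟩)
  rwa [show (a - ru - max rx 1) + (e - ry - max ru 1) + 1 + ((b - rv - max ry 1)
    + (c - rx - max rv 1) + 1) + 2 = (a - ru - max rx 1) + (e - ry - max ru 1) + (b - rv - max ry 1)
      + (c - rx - max rv 1) + 4 by omega] at this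

/-- If the corner at `x` has no chord, then the two routes from `x` to `y` along the cut quadrangle
are not both shortest. -/
lemma route_of_rx (hq : IntervalNeighborhoodClique G) (hr : rx = 0) :
    G.dist x y < (a - ru) + min ru 1 + (e - ru) ∨ G.dist x y < (c - rv) + min rv 1 + (b - rv) := by
  subst hr
  have l1 := h.ru_lt
  have l3 := h.rotate.rotate.ru_lt
  have r1 := h.cu.route hconn h.lu (i := 1) (j := e) (by omega) h.lu.le_right le_rfl
  have r2 := h.cv.route hconn h.lv (i := 0) (j := c - 1) (by omega) (by omega) (by omega)
  rw [h.cu.right.last] at r1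
  rw [h.cv.left.first, dist_comm] at r2
  by_contra hlt
  exact h.cx.not_both_closer h.lx hq h.hc h.ha (w := y) (by omega) (by omega)

/-- The lengths of the sides after cutting off the corners. -/
lemma exists_residual (hk : 2 ≤ k) : ∃ l, a = rx + ru + l ∧ (rx = 0 ∨ ru = 0 → 1 ≤ l) ∧
    a - ru - max rx 1 + 1 = l + min rx 1 := by
  have o1 := h.overlap hconn hk
  have l1 := h.ru_lt
  have l4 := h.rotate.rotate.rotate.ru_lt
  exact ⟨a - (rx + ru), by omega, by omega, by omega⟩

end Frame

/-- The `l`s are the lengths left of the sides, and `x, u, y, v` record which corners are cut. The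
four route bounds sum to `2(X + U) ≤ 2 ∑ l + (x + u + y + v)`, while a gap of `k` gives `2(X + U) ≥
∑ l + 2k`, so the cycle length is at least `2k`. For a gap of 2, length 5 leaves a total slack of
one, so some diagonal has both routes tight; running through the sixteen patterns of cut corners
supplies an uncut end. -/
lemma cut_arith {l₁ l₂ l₃ l₄ x u y v : ℕ} {X U : ℤ} (hx : x ≤ 1) (hu : u ≤ 1) (hy : y ≤ 1)
    (hv : v ≤ 1) (h1 : x = 0 ∨ u = 0 → 1 ≤ l₁) (h2 : u = 0 ∨ y = 0 → 1 ≤ l₂)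
    (h3 : y = 0 ∨ v = 0 → 1 ≤ l₃) (h4 : v = 0 ∨ x = 0 → 1 ≤ l₄)
    (r1 : X ≤ l₁ + u + l₂) (r2 : X ≤ l₃ + v + l₄) (r3 : U ≤ l₁ + x + l₄) (r4 : U ≤ l₂ + y + l₃)
    (g1 : (l₁ : ℤ) + l₃ + 2 ≤ X + U) (g2 : (l₂ : ℤ) + l₄ + 2 ≤ X + U)
    (hN : l₁ + l₂ + l₃ + l₄ + x + u + y + v ≤ 5) :
    ¬ ((l₁ : ℤ) + l₃ + 3 ≤ X + U ∧ (l₂ : ℤ) + l₄ + 3 ≤ X + U) ∧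
      (l₁ + l₂ + l₃ + l₄ + x + u + y + v ≠ 4 →
        (x = 0 ∨ y = 0) ∧ X = l₁ + u + l₂ ∧ X = l₃ + v + l₄ ∨
        (u = 0 ∨ v = 0) ∧ U = l₁ + x + l₄ ∧ U = l₂ + y + l₃) := by
  interval_cases x <;> interval_cases u <;> interval_cases y <;> interval_cases v <;>
    simp only [or_true, one_ne_zero, or_self, false_implies, true_implies,
      Nat.cast_zero, Nat.cast_one, true_and, false_and, or_false, false_or]
      at h1 h2 h3 h4 r1 r2 r3 r4 ⊢ <;> omega

namespace Frame

variable {k : ℕ} {x u y v : V} {P₁ P₂ P₃ P₄ : ℕ → V} {a e b c rx ru ry rv : ℕ}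
variable (hconn : G.Connected) (h : Frame G k x u y v P₁ P₂ P₃ P₄ a e b c rx ru ry rv)
include hconn h

lemma arith (hk : 2 ≤ k) (hchord : ∀ N, 6 ≤ N → ¬ (cycleGraph N).IsIndContained G) :
    k < 3 ∧ (¬ (cycleGraph 4).IsIndContained G →
      (rx = 0 ∨ ry = 0) ∧ G.dist x y = (a - ru) + min ru 1 + (e - ru) ∧
        G.dist x y = (c - rv) + min rv 1 + (b - rv) ∨
      (ru = 0 ∨ rv = 0) ∧ G.dist u v = (a - rx) + min rx 1 + (c - rx) ∧
        G.dist u v = (e - ry) + min ry 1 + (b - ry)) := by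
  have cyc := h.cycle hconn hk
  obtain ⟨l₁, a1, b1, c1⟩ := h.exists_residual hconn hk
  obtain ⟨l₂, a2, b2, c2⟩ := h.rotate.exists_residual hconn hk
  obtain ⟨l₃, a3, b3, c3⟩ := h.rotate.rotate.exists_residual hconn hk
  obtain ⟨l₄, a4, b4, c4⟩ := h.rotate.rotate.rotate.exists_residual hconn hk
  have r1 := h.dist_le hconn
  have r2 := h.rotate.dist_le hconn
  have r3 := h.rotate.rotate.dist_le hconn
  have r4 := h.rotate.rotate.rotate.dist_le hconn
  rw [dist_comm] at r3 r4
  obtain ⟨g1, g2⟩ := h.gap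
  have d1 := h.cu.left.dist_eq
  have d2 := h.cy.left.dist_eq
  have d3 := h.cv.left.dist_eq
  have d4 := h.cx.left.dist_eq
  rw [dist_comm] at d4
  rw [d1, d3] at g1
  rw [d4, d2] at g2
  clear d1 d2 d3 d4
  have key : ∀ r, min r 1 ≤ 1 ∧ (min r 1 = 0 → r = 0) := fun r => ⟨by omega, by omega⟩
  obtain ⟨kx, kx0⟩ := key rx
  obtain ⟨ku, ku0⟩ := key ru
  obtain ⟨ky, ky0⟩ := key ry
  obtain ⟨kv, kv0⟩ := key rv
  generalize a - ru - max rx 1 = n₁ at cyc c1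
  generalize e - ry - max ru 1 = n₂ at cyc c2
  generalize b - rv - max ry 1 = n₃ at cyc c3
  generalize c - rx - max rv 1 = n₄ at cyc c4
  generalize min rx 1 = mx at *
  generalize min ru 1 = mu at *
  generalize min ry 1 = my at *
  generalize min rv 1 = mv at *
  have hn : n₁ + n₂ + n₃ + n₄ + 4 = l₁ + l₂ + l₃ + l₄ + mx + mu + my + mv := by
    clear r1 r2 r3 r4 g1 g2 a1 a2 a3 a4 b1 b2 b3 b4 kx0 ku0 ky0 kv0
    omega
  rw [hn] at cyc
  clear c1 c2 c3 c4 hn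
  rw [show a - ru = rx + l₁ by omega, show e - ru = ry + l₂ by omega] at r1 ⊢
  rw [show e - ry = ru + l₂ by omega, show b - ry = rv + l₃ by omega] at r2 ⊢
  rw [show b - rv = ry + l₃ by omega, show c - rv = rx + l₄ by omega] at r3 ⊢
  rw [show c - rx = rv + l₄ by omega, show a - rx = ru + l₁ by omega] at r4 ⊢
  rw [a1, a3] at g1
  rw [a2, a4] at g2
  have hN : l₁ + l₂ + l₃ + l₄ + mx + mu + my + mv ≤ 5 := by
    by_contra hlt
    exact hchord _ (by omega) cyc
  -- Each diagonal is reduced by the cut depths at its ends, so these depths cancel from every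
  -- inequality; integers avoid truncated subtraction.
  obtain ⟨t1, t2⟩ := cut_arith (X := (G.dist x y : ℤ) - rx - ry) (U := (G.dist u v : ℤ) - ru - rv)
    kx ku ky kv (fun hh => b1 (hh.imp kx0 ku0)) (fun hh => b2 (hh.imp ku0 ky0))
    (fun hh => b3 (hh.imp ky0 kv0)) (fun hh => b4 (hh.imp kv0 kx0))
    (by clear r2 r3 r4 g1 g2; omega) (by clear r1 r2 r4 g1 g2; omega)
    (by clear r1 r2 r3 g1 g2; omega) (by clear r1 r3 r4 g1 g2; omega)
    (by clear r1 r2 r3 r4; omega) (by clear r1 r2 r3 r4; omega) hN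
  clear r1 r2 r3 r4
  refine ⟨by omega, fun hC4 => ?_⟩
  rcases t2 (fun h4 => hC4 (h4 ▸ cyc)) with ⟨p1, p2, p3⟩ | ⟨p1, p2, p3⟩
  · exact Or.inl ⟨p1.imp kx0 ky0, by omega, by omega⟩
  · exact Or.inr ⟨p1.imp ku0 kv0, by omega, by omega⟩

lemma false_of_clique (hk : 2 ≤ k) (hcyc : OnlyShortOddCycles G)
    (hq : IntervalNeighborhoodClique G) : False := by
  have q1 := h.route_of_rx hconn hq
  have q2 := h.rotate.route_of_rx hconn hq
  have q3 := h.rotate.rotate.route_of_rx hconn hq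
  have q4 := h.rotate.rotate.rotate.route_of_rx hconn hq
  simp only [G.dist_comm (u := y) (v := x)] at q3
  simp only [G.dist_comm (u := v) (v := u)] at q4
  rcases (h.arith hconn hk fun N hN => hcyc N (Or.inr hN)).2 (hcyc 4 (Or.inl rfl)) with
    ⟨p1 | p1, p2, p3⟩ | ⟨p1 | p1, p2, p3⟩
  · have := q1 p1; omega
  · have := q3 p1; omega
  · have := q2 p1; omega
  · have := q4 p1; omega

end Frame

/-! ### The pentagon beside an adjacency between opposite sides -/

namespace Corner

variable {v x w : V} {A D : ℕ → V} {c α β : ℕ}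

/-- If `ww'q` is a triangle, `q` lies on `D` at the same distance from the corner `x` as `w`, and
`w'` is farther from `x`, then `w` is adjacent to `x`. -/
lemma le_one_of_triangle (hc : G.Connected) (hq : IntervalNeighborhoodClique G)
    (h : Corner G v x w D c A α) (hcc : c = α + β) {w' : V} (wq : G.Adj w (D β))
    (qw : G.Adj (D β) w') (ww : G.Adj w w') (hxw : G.dist x w' = α + 1) (hβ : 1 ≤ β) : α ≤ 1 := by
  by_contra hα
  have a1 := h.left.geo.adj (i := c - 1) (by omega)
  rw [Nat.sub_add_cancel (by omega), h.left.last] at a1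
  have a2 := h.right.geo.adj (i := 0) (by omega)
  rw [h.right.first, zero_add] at a2
  have a3 : G.Adj (A 1) (A 2) := h.right.geo.adj (by omega)
  have e1 := h.right.dist_last (i := 1) (by omega)
  have e2 := h.right.dist_last (i := 2) (by omega)
  have e3 := h.left.geo β (c - 1) (by omega) (by omega)
  have e4 := h.left.dist_first (i := β) (by omega)
  have e5 := h.left.dist_eq
  have e6 := h.right.dist_eq
  have e7 := h.right.dist_first (i := 1) (by omega)
  rw [dist_comm] at e3 e4 e5
  have f1 := dist_eq_one_iff_adj.2 wq
  have f2 := dist_eq_one_iff_adj.2 qw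
  have f3 := dist_eq_one_iff_adj.2 ww
  have t1 := hc.dist_triangle (u := A 1) (v := w) (w := w')
  have t2 := hc.dist_triangle (u := D (c - 1)) (v := D β) (w := w')
  have b1 := hq x w' _ _ a1.symm a2 (h.ne (by omega) (by omega)) (by omega) (by omega)
  have hfar : α ≤ G.dist (A 1) (D β) := by
    by_contra hlt
    have t3 := hc.dist_triangle (u := A 1) (v := D β) (w := v)
    have t4 := hc.dist_triangle (u := x) (v := A 1) (w := v)
    have := h.only (A 1) (by omega) (by omega)
    rw [this, dist_self] at e7
    omega
  have t5 := hc.dist_triangle (u := A 2) (v := w) (w := D β)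
  -- Seen from `A 1`, both `D (c - 1)` and `A 2` are closer to `D β`. The resulting edge joins
  -- levels 1 and 2 of the corner at `x`, which `eq_of_adj` forbids.
  have b2 := hq (A 1) (D β) _ _ b1.symm a3 (h.ne (by omega) (by omega))
    (by omega) (by omega)
  have := h.eq_of_adj hc (by omega) (by omega) (by omega) b2
  omega

/-- A geodesic pentagon-like cycle `w' → v → x → w → w'` has short sides at `w` and `w'`. -/
lemma eq_one_of_adj (hc : G.Connected) (hcyc : OnlyShortOddCycles G)
    (hq : IntervalNeighborhoodClique G) {w' : V} {B : ℕ → V} (h₁ : Corner G w' v x B β D c)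
    (h₂ : Corner G v x w D c A α) (ww : G.Adj w w') (hα : 1 ≤ α) (hβ : 1 ≤ β) (hcc : c = α + β)
    (hxw : G.dist x w' = α + 1) (hvw : G.dist v w = β + 1) : α = 1 ∧ β = 1 := by
  obtain ⟨rv, hrv⟩ := exists_lastChord G B β D c
  obtain ⟨rx, hrx⟩ := exists_lastChord G D c A α
  have lv := hrv.le_left
  have lx := hrx.le_right
  have hBA : ∀ s t, s ≤ β → t ≤ α → B s ≠ A t ∧ (G.Adj (B s) (A t) ↔ s = 0 ∧ t = α) := by
    intro s t hs ht
    have d1 := h₁.left.dist_last hs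
    have d2 := h₂.right.dist_first ht
    have d3 := h₂.left.dist_eq
    rw [dist_comm] at d1
    rw [dist_comm] at d2
    have hww := dist_eq_one_iff_adj.2 ww
    constructor
    · intro he
      have t1 := hc.dist_triangle (u := v) (v := B s) (w := x)
      rw [he] at t1 d1
      obtain rfl : s = 0 := by omega
      obtain rfl : t = α := by omega
      rw [h₁.left.first, h₂.right.last] at he
      exact ww.ne he.symm
    · constructor
      · intro ha
        have l1 := Adj.le_succ_dist hc ha x
        have t1 := hc.dist_triangle (u := v) (v := B s) (w := x)
        have l2 := Adj.le_succ_dist hc ha.symm v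
        rw [G.dist_comm (v := v), G.dist_comm (v := v)] at l2
        constructor
        · by_contra hs0
          obtain rfl : t = α := by omega
          rw [h₂.right.last] at l2
          omega
        · by_contra htα
          obtain rfl : s = 0 := by omega
          rw [h₁.left.first, dist_comm] at l1
          omega
      · rintro ⟨rfl, rfl⟩
        rw [h₁.left.first, h₂.right.last]
        exact ww.symm
  have p1 := (h₁.left.geo.mono (m := β - rv) (by omega)).isIndPath
  have p2 := (h₂.left.geo.shift (max rv 1) (m := c - rx - max rv 1) (by omega)).isIndPath
  have p3 := (h₂.right.geo.shift (max rx 1) (m := α - max rx 1) (by omega)).isIndPath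
  have q1 := p1.glue p2 (fun i j hi hj => by
    obtain ⟨n, m⟩ := h₁.cross hc hrv (i := i) (j := max rv 1 + j) (by omega) (by omega) (by omega)
    exact ⟨n, m.trans (by omega)⟩)
  have cyc := q1.cycle p3 (fun i j hi hj => by
    by_cases hi' : i ≤ β - rv
    · rw [glue_left hi']
      obtain ⟨n, m⟩ := hBA i (max rx 1 + j) (by omega) (by omega)
      exact ⟨n, m.trans (by omega)⟩
    · rw [glue_right hi']
      obtain ⟨n, m⟩ := h₂.cross hc hrx (i := max rv 1 + (i - (β - rv + 1))) (j := max rx 1 + j)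
        (by omega) (by omega) (by omega)
      exact ⟨n, m.trans (by omega)⟩)
  have hN : ∀ N, (cycleGraph N).IsIndContained G → N ≠ 4 ∧ N ≤ 5 := by
    intro N h
    constructor
    · rintro rfl; exact hcyc 4 (Or.inl rfl) h
    · by_contra hlt; exact hcyc N (Or.inr (by omega)) h
  obtain ⟨n4, n5⟩ := hN _ cyc
  -- Uncut, the cycle has length `2c + 1`; a cut of depth `r ≥ 1` removes `2r - 1`. One cut alone
  -- would leave an even cycle, and after two cuts length 3 or 5 forces at least one of them to full
  -- depth.
  have hcases : (α = 1 ∧ β = 1) ∨ ((rx = α ∨ rv = β) ∧ 1 ≤ rx ∧ 1 ≤ rv) := by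
    clear p1 p2 p3 q1 cyc hBA
    omega
  rcases hcases with hone | ⟨hr, hx1, hv1⟩
  · exact hone
  -- The clique property is applied from `w'` towards `x`, and conversely from `w` towards `v`.
  have hqw : G.Adj (B 0) (D β) ↔ G.Adj (D β) (A α) := by
    have e1 := h₂.left.dist_first (i := β) (by omega)
    have e2 := h₂.left.dist_last (i := β) (by omega)
    have e3 := h₁.left.dist_eq
    have e4 := h₂.right.dist_eq
    rw [h₁.left.first, h₂.right.last]
    constructor
    · intro ha
      refine hq w' x (D β) w ha ww.symm ?_ ?_ ?_
      · rw [← h₂.right.last]; exact h₂.ne (by omega) le_rfl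
      · rw [dist_comm (u := w')]; omega
      · rw [dist_comm (u := w'), dist_comm (u := w)]; omega
    · intro ha
      refine hq w v w' (D β) ww ha.symm ?_ ?_ ?_
      · rw [← h₁.left.first]; exact h₁.ne (by omega) (by omega)
      · rw [dist_comm (u := w)]; omega
      · rw [dist_comm (u := w), dist_comm (u := D β)]; omega
  have hboth : G.Adj (B 0) (D β) ∧ G.Adj (D β) (A α) := by
    rcases hr with rfl | rfl
    · have := hrx.adj hx1
      rw [show c - rx = β by omega] at this
      exact ⟨hqw.2 this, this⟩
    · have := hrv.adj hv1
      rw [Nat.sub_self] at this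
      exact ⟨this, hqw.1 this⟩
  rw [h₁.left.first, h₂.right.last] at hboth
  obtain ⟨hb1, hb2⟩ := hboth
  have r1 := h₂.le_one_of_triangle hc hq hcc hb2.symm hb1.symm ww hxw hβ
  have r2 := h₁.symm.le_one_of_triangle hc hq (β := α) (by omega)
    (by rw [show c - α = β by omega]; exact hb1) (by rw [show c - α = β by omega]; exact hb2)
    ww.symm hvw hα
  exact ⟨by omega, by omega⟩

end Corner

/-! ### Opposite sides of a minimal gap quadruple -/

namespace MinGap

variable {k : ℕ} {x u y v : V} {P₁ P₂ P₃ P₄ : ℕ → V} {a e b c i j : ℕ}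

lemma cornerAt (hc : G.Connected) (h : MinGap G k x u y v) (s₄ : Side G v x P₄ c)
    (s₁ : Side G x u P₁ a) : Corner G v x u P₄ c P₁ a :=
  ⟨s₄, s₁, fun _ h1 h2 => h.corner hc h1 h2⟩

lemma opposite_ne (hc : G.Connected) (h : MinGap G k x u y v) (hk : 1 ≤ k)
    (s₁ : Side G x u P₁ a) (s₃ : Side G y v P₃ b) (hi : i ≤ a) (hj : j ≤ b) : P₁ i ≠ P₃ j := by
  intro he
  have d1 := s₁.dist_first hi
  have d2 := s₁.dist_last hi
  have d3 := s₃.dist_first hj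
  have d4 := s₃.dist_last hj
  have d5 := s₁.dist_eq
  have d6 := s₃.dist_eq
  rw [dist_comm] at d2 d3
  rw [← he] at d3 d4
  have t1 := hc.dist_triangle (u := x) (v := P₁ i) (w := y)
  have t2 := hc.dist_triangle (u := u) (v := P₁ i) (w := v)
  obtain ⟨g1, g2⟩ := h.gap
  omega

/-- Routing both diagonals through the edge bounds the diagonal sum by `a + b + 2`, so a gap of at
least 2 makes every estimate an equality. -/
lemma opposite_adj (hc : G.Connected) (h : MinGap G k x u y v) (hk : 2 ≤ k)
    (s₁ : Side G x u P₁ a) (s₃ : Side G y v P₃ b) (hi : i ≤ a) (hj : j ≤ b)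
    (ha : G.Adj (P₁ i) (P₃ j)) :
    k = 2 ∧ G.dist x y = i + 1 + j ∧ G.dist u v = (a - i) + 1 + (b - j) := by
  have d1 := s₁.dist_first hi
  have d2 := s₁.dist_last hi
  have d3 := s₃.dist_first hj
  have d4 := s₃.dist_last hj
  have d5 := s₁.dist_eq
  have d6 := s₃.dist_eq
  have d7 := dist_eq_one_iff_adj.2 ha
  rw [dist_comm] at d2 d3
  have t1 := hc.dist_triangle (u := x) (v := P₁ i) (w := y)
  have t2 := hc.dist_triangle (u := u) (v := P₁ i) (w := v)
  have t3 := hc.dist_triangle (u := P₁ i) (v := P₃ j) (w := y)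
  have t4 := hc.dist_triangle (u := P₁ i) (v := P₃ j) (w := v)
  obtain ⟨g1, g2⟩ := h.gap
  omega

lemma eq_one_of_adj (hc : G.Connected) (hcyc : OnlyShortOddCycles G)
    (hq : IntervalNeighborhoodClique G) (h : MinGap G 2 x u y v) (s₁ : Side G x u P₁ a)
    (s₃ : Side G y v P₃ b) (s₄ : Side G v x P₄ c) (hi : i ≤ a) (hj : j ≤ b)
    (ha : G.Adj (P₁ i) (P₃ j)) (h1 : ¬ (i = a ∧ j = 0)) (h2 : ¬ (i = 0 ∧ j = b)) :
    i = 1 ∧ b - j = 1 ∧ c = 2 := by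
  obtain ⟨-, hX, hU⟩ := h.opposite_adj hc le_rfl s₁ s₃ hi hj ha
  have d1 := s₁.dist_first hi
  have d2 := s₁.dist_last hi
  have d3 := s₃.dist_first hj
  have d4 := s₃.dist_last hj
  have d5 := s₁.dist_eq
  have d6 := s₃.dist_eq
  have d7 := dist_eq_one_iff_adj.2 ha
  have d8 := s₄.dist_eq
  have c1 := G.dist_comm (u := x) (v := v)
  have c2 := G.dist_comm (u := u) (v := P₁ i)
  have c3 := G.dist_comm (u := y) (v := P₃ j)
  have c4 := G.dist_comm (u := P₃ j) (v := x)
  have c5 := G.dist_comm (u := P₃ j) (v := P₁ i)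
  have c6 := G.dist_comm (u := P₁ i) (v := v)
  have t1 := hc.dist_triangle (u := x) (v := P₁ i) (w := P₃ j)
  have t2 := hc.dist_triangle (u := x) (v := P₃ j) (w := y)
  have t3 := hc.dist_triangle (u := P₁ i) (v := P₃ j) (w := v)
  have t4 := hc.dist_triangle (u := u) (v := P₁ i) (w := v)
  have t5 := hc.dist_triangle (u := u) (v := P₁ i) (w := P₃ j)
  have t6 := hc.dist_triangle (u := u) (v := P₃ j) (w := v)
  have t7 := hc.dist_triangle (u := P₁ i) (v := P₃ j) (w := y)
  have t8 := hc.dist_triangle (u := x) (v := P₁ i) (w := y)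
  obtain ⟨g1, g2⟩ := h.gap
  have e1 := h.side_pos hc (by omega)
  have e2 := h.rotate.side_pos hc (by omega)
  have e3 := h.rotate.rotate.rotate.side_pos hc (by omega)
  -- The edge splits the quadrangle in two. If either part violated its bound, it would be a gap
  -- quadruple of smaller perimeter; the original gap then turns both bounds into equalities.
  have hleft : i + (b - j) ≤ c := by
    by_contra hlt
    have hg : Gap G 2 x (P₁ i) (P₃ j) v := ⟨by omega, by omega⟩
    have := h.min _ _ _ _ hg
    omega
  have hright : (a - i) + j ≤ G.dist u y := by
    by_contra hlt
    have hg : Gap G 2 (P₁ i) u y (P₃ j) := ⟨by omega, by omega⟩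
    have := h.min _ _ _ _ hg
    omega
  have hcc : c = i + (b - j) := by omega
  have hα : 1 ≤ i := by
    by_contra hlt
    obtain rfl : i = 0 := by omega
    have hx : G.dist (P₁ 0) v = G.dist x v := by rw [s₁.first]
    omega
  have hβ : 1 ≤ b - j := by
    by_contra hlt
    obtain rfl : j = b := by omega
    have hv : G.dist x (P₃ j) = G.dist x v := by rw [s₃.last]
    omega
  -- A vertex between `v` and `P₃ j` also lies between `v` and `y`, so the corner condition passes
  -- to the shortened side.
  have k₁ : Corner G (P₃ j) v x (fun t => P₃ (j + t)) (b - j) P₄ c := by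
    refine ⟨s₃.drop hj, s₄, fun p p1 p2 => ?_⟩
    refine h.rotate.rotate.rotate.corner hc ?_ p2
    have t1 := hc.dist_triangle (u := p) (v := P₃ j) (w := y)
    have t2 := hc.dist_triangle (u := v) (v := p) (w := y)
    have c1 := G.dist_comm (u := v) (v := P₃ j)
    have c2 := G.dist_comm (u := v) (v := y)
    omega
  have k₂ : Corner G v x (P₁ i) P₄ c P₁ i := by
    refine ⟨s₄, s₁.take hi, fun p p1 p2 => ?_⟩
    refine h.corner hc p1 ?_
    have t1 := hc.dist_triangle (u := p) (v := P₁ i) (w := u)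
    have t2 := hc.dist_triangle (u := x) (v := p) (w := u)
    omega
  obtain ⟨r1, r2⟩ := k₁.eq_one_of_adj hc hcyc hq k₂ ha hα hβ hcc (by omega) (by omega)
  exact ⟨r1, r2, by omega⟩

lemma appears_of_adj (hc : G.Connected) (hcyc : OnlyShortOddCycles G)
    (hq : IntervalNeighborhoodClique G) (h : MinGap G 2 x u y v) (s₁ : Side G x u P₁ a)
    (s₂ : Side G u y P₂ e) (s₃ : Side G y v P₃ b) (s₄ : Side G v x P₄ c) (hi : i ≤ a) (hj : j ≤ b)
    (ha : G.Adj (P₁ i) (P₃ j)) (h1 : ¬ (i = a ∧ j = 0)) (h2 : ¬ (i = 0 ∧ j = b)) :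
    AppearsIsometrically H1 G ∨ AppearsIsometrically H2 G := by
  obtain ⟨r1, r2, r3⟩ := h.eq_one_of_adj hc hcyc hq s₁ s₃ s₄ hi hj ha h1 h2
  obtain ⟨r4, r5, r6⟩ := h.rotate.rotate.eq_one_of_adj hc hcyc hq s₃ s₁ s₂ hj hi ha.symm
    (by omega) (by omega)
  obtain ⟨-, hX, hU⟩ := h.opposite_adj hc le_rfl s₁ s₃ hi hj ha
  obtain rfl : a = 2 := by omega
  obtain rfl : b = 2 := by omega
  subst r1 r3 r4 r6
  have adjs : ∀ {s t : V} {P : ℕ → V}, Side G s t P 2 → G.Adj s (P 1) ∧ G.Adj (P 1) t := by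
    intro s t P hs
    have b1 := hs.geo.adj (i := 0) (by omega)
    have b2 := hs.geo.adj (i := 1) (by omega)
    rw [hs.first] at b1
    rw [hs.last] at b2
    exact ⟨b1, b2⟩
  have sq : IsSquare G x (P₁ 1) u (P₂ 1) y (P₃ 1) v (P₄ 1) :=
    { xa := (adjs s₁).1, au := (adjs s₁).2, uc := (adjs s₂).1, cy := (adjs s₂).2
      yd := (adjs s₃).1, dv := (adjs s₃).2, vb := (adjs s₄).1, bx := (adjs s₄).2
      ad := ha, xy := by omega, uv := by omega
      xu := s₁.dist_eq.ge, uy := s₂.dist_eq.ge, yv := s₃.dist_eq.ge, vx := s₄.dist_eq.ge }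
  exact sq.appears hc hcyc hq

/-- Without adjacencies between opposite sides, the quadrangle is a frame. -/
lemma exists_frame (hc : G.Connected) (h : MinGap G k x u y v) (hk : 2 ≤ k)
    (s₁ : Side G x u P₁ a) (s₂ : Side G u y P₂ e) (s₃ : Side G y v P₃ b) (s₄ : Side G v x P₄ c)
    (h13 : ∀ i j, i ≤ a → j ≤ b → G.Adj (P₁ i) (P₃ j) → (i = a ∧ j = 0) ∨ (i = 0 ∧ j = b))
    (h24 : ∀ i j, i ≤ e → j ≤ c → G.Adj (P₂ i) (P₄ j) → (i = e ∧ j = 0) ∨ (i = 0 ∧ j = c)) :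
    ∃ rx ru ry rv, Frame G k x u y v P₁ P₂ P₃ P₄ a e b c rx ru ry rv := by
  obtain ⟨rx, hrx⟩ := exists_lastChord G P₄ c P₁ a
  obtain ⟨ru, hru⟩ := exists_lastChord G P₁ a P₂ e
  obtain ⟨ry, hry⟩ := exists_lastChord G P₂ e P₃ b
  obtain ⟨rv, hrv⟩ := exists_lastChord G P₃ b P₄ c
  refine ⟨rx, ru, ry, rv, ?_⟩
  have k1 : 1 ≤ k := by omega
  exact
    { gap := h.gap
      cu := h.rotate.cornerAt hc s₁ s₂
      cy := h.rotate.rotate.cornerAt hc s₂ s₃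
      cv := h.rotate.rotate.rotate.cornerAt hc s₃ s₄
      cx := h.cornerAt hc s₄ s₁
      lu := hru
      ly := hry
      lv := hrv
      lx := hrx
      opp₁ := fun i j hi hj => ⟨h.opposite_ne hc k1 s₁ s₃ hi hj, h13 i j hi hj⟩
      opp₂ := fun i j hi hj => ⟨h.rotate.opposite_ne hc k1 s₂ s₄ hi hj, h24 i j hi hj⟩
      ha := s₁.dist_eq ▸ h.side_pos hc k1
      he := s₂.dist_eq ▸ h.rotate.side_pos hc k1
      hb := s₃.dist_eq ▸ h.rotate.rotate.side_pos hc k1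
      hc := s₄.dist_eq ▸ h.rotate.rotate.rotate.side_pos hc k1 }

lemma lt_three (hc : G.Connected) (hchord : ∀ N, 6 ≤ N → ¬ (cycleGraph N).IsIndContained G)
    (h : MinGap G k x u y v) (hk : 2 ≤ k) : k < 3 := by
  by_contra h3
  obtain ⟨P₁, s₁⟩ := exists_side hc x u
  obtain ⟨P₂, s₂⟩ := exists_side hc u y
  obtain ⟨P₃, s₃⟩ := exists_side hc y v
  obtain ⟨P₄, s₄⟩ := exists_side hc v x
  obtain ⟨rx, ru, ry, rv, hf⟩ := h.exists_frame hc hk s₁ s₂ s₃ s₄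
    (fun i j hi hj ha => by have := h.opposite_adj hc hk s₁ s₃ hi hj ha; omega)
    (fun i j hi hj ha => by have := h.rotate.opposite_adj hc hk s₂ s₄ hi hj ha; omega)
  exact h3 (hf.arith hc hk hchord).1

lemma appears (hc : G.Connected) (hcyc : OnlyShortOddCycles G)
    (hq : IntervalNeighborhoodClique G) (h : MinGap G 2 x u y v) :
    AppearsIsometrically H1 G ∨ AppearsIsometrically H2 G := by
  by_contra hno
  obtain ⟨P₁, s₁⟩ := exists_side hc x u
  obtain ⟨P₂, s₂⟩ := exists_side hc u y
  obtain ⟨P₃, s₃⟩ := exists_side hc y v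
  obtain ⟨P₄, s₄⟩ := exists_side hc v x
  obtain ⟨rx, ru, ry, rv, hf⟩ := h.exists_frame hc le_rfl s₁ s₂ s₃ s₄
    (fun i j hi hj ha => by
      by_contra hij
      rw [not_or] at hij
      exact hno (h.appears_of_adj hc hcyc hq s₁ s₂ s₃ s₄ hi hj ha hij.1 hij.2))
    (fun i j hi hj ha => by
      by_contra hij
      rw [not_or] at hij
      exact hno (h.rotate.appears_of_adj hc hcyc hq s₂ s₃ s₄ s₁ hi hj ha hij.1 hij.2))
  exact hf.false_of_clique hc le_rfl hcyc hq

end MinGap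

end HypChord

/-! ### The characterisation -/

theorem theorem2 {V : Type*} (G : SimpleGraph V) (hconn : G.Connected)
    (hchord : HypChord.IsKChordal 5 G) :
    (HypChord.hyperbolicity G = 1 ↔ HypChord.HasObstruction G) ∧
    (HypChord.IsHyperbolic (1 / 2) G ↔ ¬ HypChord.HasObstruction G) := by
  have hcycle : ∀ N, 6 ≤ N → ¬ (SimpleGraph.cycleGraph N).IsIndContained G :=
    fun N hN => hchord N (by omega) (by omega)
  have hone : HypChord.IsHyperbolic 1 G := by
    have := (HypChord.isHyperbolic_iff (G := G) 2).2 fun x u y v hg => by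
      obtain ⟨x', u', y', v', h⟩ := HypChord.exists_minGap ⟨x, u, y, v, hg⟩
      exact absurd (h.lt_three hconn hcycle (by omega)) (by omega)
    simpa using this
  have hhalf : HypChord.IsHyperbolic (1 / 2) G ↔ ¬ HypChord.HasObstruction G := by
    have hiff := HypChord.isHyperbolic_iff (G := G) 1
    rw [Nat.cast_one] at hiff
    rw [hiff]
    constructor
    · intro h hob
      obtain ⟨x, u, y, v, hg⟩ := hob.exists_gap hconn
      exact h x u y v hg
    · intro hno x u y v hg
      have hcyc : HypChord.OnlyShortOddCycles G := by
        rintro N (rfl | hN) hc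
        · exact hno (Or.inl (HypChord.appears_C4 hconn hc))
        · exact hcycle N hN hc
      have hq := HypChord.intervalNeighborhoodClique hconn hcyc
        (fun h => hno (Or.inr (Or.inr (Or.inr (Or.inl h)))))
        (fun h => hno (Or.inr (Or.inr (Or.inr (Or.inr (Or.inr h))))))
      obtain ⟨x', u', y', v', h⟩ := HypChord.exists_minGap ⟨x, u, y, v, hg⟩
      rcases h.appears hconn hcyc hq with h1 | h2
      · exact hno (Or.inr (Or.inl h1))
      · exact hno (Or.inr (Or.inr (Or.inl h2)))
  refine ⟨?_, hhalf⟩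
  rw [HypChord.hyperbolicity_eq_one_iff, hhalf, not_not]
  exact and_iff_right hone
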